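/- Let $K$ be a field of characteristic zero, let $n \ge 1$, let $R = K[X_1,\ldots,X_n]$, and let $P = (X_1,\ldots,X_{n-1}) \subset R$ (so $P = 0$ if $n = 1$). Let $H^{n-1}_P(R)$ be the $(n-1)$-st local cohomology module of $R$ with support in $P$, that is, the $(n-1)$-st cohomology of the Čech complex $$0 \to R \to \bigoplus_{j} R_{a_j} \to \bigoplus_{j<k} R_{a_j a_k} \to \cdots \to R_{a_1 \cdots a_s} \to 0$$ of any finite sequence $a_1,\ldots,a_s$ generating $P$, on which the partial derivatives $\partial_1,\ldots,\partial_n$ act through their unique extensions (the quotient rule) to the localizations of $R$. Let $\partial = \partial_1,\ldots,\partial_n$, and for $i \ge 0$ let $H_i(\partial; H^{n-1}_P(R))$ be the $i$-th Koszul (de Rham) homology of the $K$-vector space $H^{n-1}_P(R)$ with respect to the pairwise commuting $K$-linear operators $\partial_1,\ldots,\partial_n$. Then $$H_i(\partial; H^{n-1}_P(R)) \cong \begin{cases} 0 & \text{for } i \neq 1, \\ K & \text{for } i = 1, \end{cases}$$ as $K$-vector spaces. -/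

import Mathlib

noncomputable section

namespace DeRhamLC

/-! ### Derivations on localizations -/

section LocDerivation

variable {K R : Type*} [CommRing K] [CommRing R] [Algebra K R]

/-- For a `K`-derivation `D` of `R`, the ring homomorphism `r ↦ (r, D r)` from `R` to the
square-zero extension `M⁻¹R ⊕ M⁻¹R ε` of a localization of `R`. -/
def dualHom (D : Derivation K R R) (M : Submonoid R) :
    R →ₐ[K] TrivSqZeroExt (Localization M) (Localization M) :=
  AlgHom.ofLinearMap
    { toFun := fun r => (algebraMap R (Localization M) r, algebraMap R (Localization M) (D r))
      map_add' := fun x y => Prod.ext (map_add _ x y) (by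
        change algebraMap R (Localization M) (D (x + y)) = _ + _
        rw [map_add, map_add])
      map_smul' := fun k x => Prod.ext ((IsScalarTower.toAlgHom K R (Localization M)).toLinearMap.map_smul k x) (by
        change algebraMap R (Localization M) (D (k • x)) = k • _
        rw [D.map_smul]
        exact (IsScalarTower.toAlgHom K R (Localization M)).toLinearMap.map_smul k (D x)) }
    (Prod.ext (map_one _) (by
        change algebraMap R (Localization M) (D 1) = 0
        rw [D.map_one_eq_zero, map_zero]))
    (fun x y => Prod.ext (map_mul _ x y) (by
        change algebraMap R (Localization M) (D (x * y)) =
          algebraMap R (Localization M) x * algebraMap R (Localization M) (D y) +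
          algebraMap R (Localization M) (D x) * algebraMap R (Localization M) y
        rw [D.leibniz, map_add, smul_eq_mul, smul_eq_mul, map_mul, map_mul, mul_comm
          (algebraMap R (Localization M) y)]))

theorem isUnit_dualHom (D : Derivation K R R) (M : Submonoid R) (y : M) :
    IsUnit (dualHom D M (y : R)) := by
  rw [TrivSqZeroExt.isUnit_iff_isUnit_fst]
  exact IsLocalization.map_units (Localization M) y

/-- The extension of `dualHom` to the localization. -/
def dualLift (D : Derivation K R R) (M : Submonoid R) :
    Localization M →ₐ[K] TrivSqZeroExt (Localization M) (Localization M) :=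
  IsLocalization.liftAlgHom (M := M) (f := dualHom D M) (isUnit_dualHom D M)

theorem dualLift_algebraMap (D : Derivation K R R) (M : Submonoid R) (r : R) :
    dualLift D M (algebraMap R (Localization M) r) = dualHom D M r := by
  simp [dualLift]

theorem fst_dualLift (D : Derivation K R R) (M : Submonoid R) (x : Localization M) :
    (dualLift D M x).fst = x := by
  have h : ((TrivSqZeroExt.fstHom K (Localization M) (Localization M)).comp
      (dualLift D M)).toRingHom = RingHom.id _ := by
    apply IsLocalization.ringHom_ext M
    ext r
    change (dualLift D M (algebraMap R (Localization M) r)).fst = _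
    rw [dualLift_algebraMap]
    rfl
  exact congrArg (fun f : Localization M →+* Localization M => f x) h

/-- The unique extension of a `K`-derivation `D` of `R` to a `K`-derivation of the localization
`M⁻¹R` (given by the quotient rule). -/
def locDerivation (D : Derivation K R R) (M : Submonoid R) :
    Derivation K (Localization M) (Localization M) :=
  Derivation.mk'
    ((TrivSqZeroExt.sndHom (Localization M) (Localization M)).restrictScalars K ∘ₗ
      (dualLift D M).toLinearMap)
    (fun x y => by
      change (dualLift D M (x * y)).snd = x * (dualLift D M y).snd + y * (dualLift D M x).snd
      rw [map_mul, TrivSqZeroExt.snd_mul, fst_dualLift, fst_dualLift]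
      simp [mul_comm])

theorem locDerivation_algebraMap (D : Derivation K R R) (M : Submonoid R) (r : R) :
    locDerivation D M (algebraMap R (Localization M) r) = algebraMap R (Localization M) (D r) := by
  change (dualLift D M (algebraMap R (Localization M) r)).snd = _
  rw [dualLift_algebraMap]
  rfl

/-- The extensions of a derivation are compatible with homomorphisms of localizations. -/
theorem locDerivation_map (D : Derivation K R R) {M N : Submonoid R}
    (f : Localization M →ₐ[R] Localization N) (x : Localization M) :
    f (locDerivation D M x) = locDerivation D N (f x) := by
  obtain ⟨r, s, rfl⟩ := IsLocalization.exists_mk'_eq M x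
  set y := IsLocalization.mk' (Localization M) r s with hy
  have hm : algebraMap R (Localization M) s * y = algebraMap R (Localization M) r := by
    rw [hy, mul_comm, IsLocalization.mk'_spec]
  have hu : IsUnit (algebraMap R (Localization N) (s : R)) := by
    have := (IsLocalization.map_units (Localization M) s).map f
    rwa [f.commutes] at this
  have h1 := congrArg (fun z => f (locDerivation D M z)) hm
  have h2 := congrArg (fun z => locDerivation D N (f z)) hm
  simp only [map_mul, AlgHom.commutes, Derivation.leibniz, smul_eq_mul,
    locDerivation_algebraMap, map_add] at h1 h2
  exact hu.mul_left_cancel (add_right_cancel (h1.trans h2.symm))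

theorem locDerivation_comm {D E : Derivation K R R} (h : ∀ r, D (E r) = E (D r))
    (M : Submonoid R) (x : Localization M) :
    locDerivation D M (locDerivation E M x) = locDerivation E M (locDerivation D M x) := by
  obtain ⟨r, s, rfl⟩ := IsLocalization.exists_mk'_eq M x
  set y := IsLocalization.mk' (Localization M) r s with hy
  have hm : algebraMap R (Localization M) s * y = algebraMap R (Localization M) r := by
    rw [hy, mul_comm, IsLocalization.mk'_spec]
  have hu : IsUnit (algebraMap R (Localization M) (s : R)) := IsLocalization.map_units _ s
  have h1 := congrArg (fun z => locDerivation D M (locDerivation E M z)) hm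
  have h2 := congrArg (fun z => locDerivation E M (locDerivation D M z)) hm
  simp only [Derivation.leibniz, smul_eq_mul, locDerivation_algebraMap, map_add, h] at h1 h2
  refine hu.mul_left_cancel ?_
  linear_combination h1 - h2

end LocDerivation

/-! ### Graded pieces and signs -/

/-- The sign `(-1)^k`, where `k` is the number of elements of `T` that are smaller than `j`. -/
def alternatingSign {ι : Type*} [LinearOrder ι] (j : ι) (T : Finset ι) : ℤ :=
  (-1) ^ (T.filter (· < j)).card

/-- For a family `V` of modules indexed by finite sets, the families in `∏ S, V S` that are
concentrated on the sets with `p` elements, i.e. the submodule `∏_{|S| = p} V S`. -/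
def gradedPiece (A : Type*) [Ring A] {ι : Type*} (V : Finset ι → Type*)
    [∀ S, AddCommGroup (V S)] [∀ S, Module A (V S)] (p : ℕ) : Submodule A (∀ S, V S) where
  carrier := {c | ∀ S, S.card ≠ p → c S = 0}
  add_mem' := fun ha hb S hS => by simp [ha S hS, hb S hS]
  zero_mem' := fun _ _ => rfl
  smul_mem' := fun r c hc S hS => by simp [hc S hS]

theorem alternatingSign_swap {ι : Type*} [LinearOrder ι] {j k : ι} {T : Finset ι} (hjk : j ≠ k)
    (hj : j ∉ T) (hk : k ∉ T) :
    alternatingSign j T * alternatingSign k (insert j T) =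
      -(alternatingSign k T * alternatingSign j (insert k T)) := by
  have key : ∀ a b : ι, a ∉ T → alternatingSign b (insert a T) =
      if a < b then -alternatingSign b T else alternatingSign b T := by
    intro a b ha
    unfold alternatingSign
    rw [Finset.filter_insert]
    split_ifs with h
    · rw [Finset.card_insert_of_notMem (by simp [ha]), pow_succ]; ring
    · rfl
  rw [key j k hj, key k j hk]
  rcases lt_or_gt_of_ne hjk with h | h
  · rw [if_pos h, if_neg h.le.not_gt]; ring
  · rw [if_neg h.le.not_gt, if_pos h]; ring

/-! ### The Čech complex and local cohomology -/

section Cech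

variable {R : Type*} [CommRing R] {s : ℕ} (a : Fin s → R)

/-- The localization `R_{a_S}` of `R` at the product `a_S = ∏_{j ∈ S} a_j`. -/
abbrev CechLoc (S : Finset (Fin s)) : Type _ := Localization.Away (∏ j ∈ S, a j)

/-- The localization map `R_{a_S} → R_{a_T}` for `S ⊆ T`. -/
def cechRestrict {S T : Finset (Fin s)} (h : S ⊆ T) : CechLoc a S →ₐ[R] CechLoc a T :=
  IsLocalization.Away.liftAlgHom (∏ j ∈ S, a j) (f := Algebra.ofId R (CechLoc a T))
    (IsLocalization.Away.isUnit_of_dvd (S := CechLoc a T) (∏ j ∈ T, a j)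
      (Finset.prod_dvd_prod_of_subset S T a h))

/-- The total Čech module `∏_S R_{a_S}`; its degree `p` part is `∏_{|S| = p} R_{a_S}`. -/
abbrev CechCochain : Type _ := ∀ S : Finset (Fin s), CechLoc a S

/-- The Čech differential
`(d c)_T = ∑_{j ∈ T} (-1)^{#{i ∈ T : i < j}} c_{T \ {j}} |_{R_{a_T}}`, which raises the degree
by one. -/
def cechD : CechCochain a →ₗ[R] CechCochain a :=
  LinearMap.pi fun T => ∑ j ∈ T, alternatingSign j T •
    ((cechRestrict a (Finset.erase_subset j T)).toLinearMap ∘ₗ LinearMap.proj (T.erase j))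

theorem cechD_apply (c : CechCochain a) (T : Finset (Fin s)) :
    cechD a c T = ∑ j ∈ T, alternatingSign j T •
      cechRestrict a (Finset.erase_subset j T) (c (T.erase j)) := by
  simp [cechD, LinearMap.sum_apply]

theorem cechRestrict_comp {S T U : Finset (Fin s)} (h : S ⊆ T) (h' : T ⊆ U) (x : CechLoc a S) :
    cechRestrict a h' (cechRestrict a h x) = cechRestrict a (h.trans h') x := by
  have e : ((cechRestrict a h').comp (cechRestrict a h)).toRingHom =
      (cechRestrict a (h.trans h')).toRingHom := by
    apply IsLocalization.ringHom_ext (Submonoid.powers (∏ j ∈ S, a j))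
    ext r
    simp
  exact congrArg (fun f : CechLoc a S →+* CechLoc a U => f x) e

theorem cechD_comp_cechD (c : CechCochain a) : cechD a (cechD a c) = 0 := by
  ext T
  simp only [cechD_apply, map_sum, Finset.smul_sum, Pi.zero_apply, map_zsmul, cechRestrict_comp,
    smul_smul]
  rw [Finset.sum_sigma']
  refine Finset.sum_involution (fun x _ => ⟨x.2, x.1⟩) ?_ ?_ ?_ ?_
  · rintro ⟨j, k⟩ hx
    simp only [Finset.mem_sigma, Finset.mem_erase] at hx
    obtain ⟨hj, hkj, hk⟩ := hx
    have aux : ∀ (U V : Finset (Fin s)) (hU : U ⊆ T) (hV : V ⊆ T), U = V →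
        cechRestrict a hU (c U) = cechRestrict a hV (c V) := by
      rintro U _ hU hV rfl; rfl
    have hs := alternatingSign_swap (T := (T.erase j).erase k) (Ne.symm hkj)
      (by simp) (by simp)
    rw [Finset.insert_erase (by simp [hkj, hk] : k ∈ T.erase j), Finset.erase_right_comm,
      Finset.insert_erase (by simp [hkj.symm, hj] : j ∈ T.erase k)] at hs
    have key : ∀ a b : Fin s, a ∈ T → a ≠ b → alternatingSign b T =
        (if a < b then -1 else 1) * alternatingSign b (T.erase a) := by
      intro a b ha hab
      conv_lhs => rw [← Finset.insert_erase ha]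
      unfold alternatingSign
      rw [Finset.filter_insert]
      split_ifs with h
      · rw [Finset.card_insert_of_notMem (by simp), pow_succ]; ring
      · ring
    rw [aux _ _ _ ((Finset.erase_subset _ _).trans (Finset.erase_subset _ _))
      (Finset.erase_right_comm (s := T) (a := j) (b := k)), ← add_smul]
    rw [key k j hk hkj, key j k hj hkj.symm]
    rcases lt_or_gt_of_ne hkj with h | h
    · rw [if_pos h, if_neg h.le.not_gt]
      convert zero_smul ℤ _ using 2; ring
    · rw [if_neg h.le.not_gt, if_pos h]
      convert zero_smul ℤ _ using 2; ring
  · rintro ⟨j, k⟩ hx _ h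
    simp only [Finset.mem_sigma, Finset.mem_erase] at hx
    simp only [Sigma.mk.injEq, heq_eq_eq] at h
    exact hx.2.1 h.1
  · rintro ⟨j, k⟩ hx
    simp only [Finset.mem_sigma, Finset.mem_erase] at hx ⊢
    exact ⟨hx.2.2, hx.2.1.symm, hx.1⟩
  · rintro ⟨j, k⟩ _; rfl

/-- Čech cocycles of degree `p`. -/
def cechCocycles (p : ℕ) : Submodule R (CechCochain a) :=
  gradedPiece R (CechLoc a) p ⊓ LinearMap.ker (cechD a)

/-- Čech coboundaries of degree `p`: since `d` is homogeneous of degree one, these are the elements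
of the image of `d` that lie in degree `p`. -/
def cechCoboundaries (p : ℕ) : Submodule R (cechCocycles a p) :=
  (LinearMap.range (cechD a)).comap (cechCocycles a p).subtype

/-- The `p`-th Čech cohomology module of `R` with respect to the finite sequence `a`. If `R` is
Noetherian and `I` is the ideal generated by `a`, this is the local cohomology module
`H^p_I(R)`. -/
abbrev CechCohomology (p : ℕ) : Type _ := cechCocycles a p ⧸ cechCoboundaries a p

variable {K : Type*} [CommRing K] [Algebra K R]

/-- A derivation of `R` acts on the Čech module through its extensions to all `R_{a_S}`. -/
def cechAction (D : Derivation K R R) : Module.End K (CechCochain a) :=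
  LinearMap.pi fun S =>
    (locDerivation D (Submonoid.powers (∏ j ∈ S, a j)) : CechLoc a S →ₗ[K] CechLoc a S) ∘ₗ
      LinearMap.proj S

theorem cechAction_apply (D : Derivation K R R) (c : CechCochain a) (S : Finset (Fin s)) :
    cechAction a D c S = locDerivation D (Submonoid.powers (∏ j ∈ S, a j)) (c S) := rfl

theorem cechD_cechAction (D : Derivation K R R) (c : CechCochain a) :
    cechD a (cechAction a D c) = cechAction a D (cechD a c) := by
  ext T
  simp only [cechD_apply, cechAction_apply, map_sum, map_zsmul]
  refine Finset.sum_congr rfl fun j _ => ?_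
  rw [locDerivation_map]

theorem cechAction_mem (D : Derivation K R R) (p : ℕ) {c : CechCochain a}
    (hc : c ∈ cechCocycles a p) : cechAction a D c ∈ cechCocycles a p := by
  refine ⟨fun S hS => ?_, ?_⟩
  · rw [cechAction_apply, hc.1 S hS, map_zero]
  · change cechD a (cechAction a D c) = 0
    rw [cechD_cechAction, LinearMap.mem_ker.1 hc.2, map_zero]

/-- The action of a derivation of `R` on the Čech cocycles of degree `p`. -/
def cocycleAction (D : Derivation K R R) (p : ℕ) : Module.End K (cechCocycles a p) where
  toFun c := ⟨cechAction a D c.1, cechAction_mem a D p c.2⟩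
  map_add' x y := Subtype.ext (map_add (cechAction a D) x.1 y.1)
  map_smul' k x := Subtype.ext (map_smul (cechAction a D) k x.1)

/-- The induced action of a derivation of `R` on the local cohomology module. -/
def cohomologyAction (D : Derivation K R R) (p : ℕ) : Module.End K (CechCohomology a p) :=
  ((cechCoboundaries a p).restrictScalars K).mapQ ((cechCoboundaries a p).restrictScalars K)
    (cocycleAction a D p) (by
      rintro x ⟨y, hy⟩
      exact ⟨cechAction a D y, by rw [cechD_cechAction, hy]; rfl⟩)

theorem cohomologyAction_mk (D : Derivation K R R) (p : ℕ) (c : cechCocycles a p) :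
    cohomologyAction a D p (Submodule.Quotient.mk c) =
      Submodule.Quotient.mk (cocycleAction a D p c) := rfl

end Cech

/-! ### Koszul (de Rham) homology -/

section Koszul

variable {K M ι : Type*} [CommRing K] [AddCommGroup M] [Module K M] [Fintype ι] [LinearOrder ι]

/-- The Koszul differential of a family `φ` of endomorphisms of `M` on `⨁_S M e_S`:
`(d m)_T = ∑_{j ∉ T} (-1)^{#{i ∈ T : i < j}} φ_j (m_{T ∪ {j}})`, i.e.
`d (m e_{j_0 < ⋯ < j_p}) = ∑_k (-1)^k φ_{j_k} m e_{j_0 ⋯ ĵ_k ⋯ j_p}`. It lowers the degree by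
one. -/
def koszulD (φ : ι → Module.End K M) : Module.End K (Finset ι → M) :=
  LinearMap.pi fun T => ∑ j ∈ Tᶜ, alternatingSign j T • (φ j ∘ₗ LinearMap.proj (insert j T))

theorem koszulD_apply (φ : ι → Module.End K M) (m : Finset ι → M) (T : Finset ι) :
    koszulD φ m T = ∑ j ∈ Tᶜ, alternatingSign j T • φ j (m (insert j T)) := by
  simp [koszulD, LinearMap.sum_apply]

theorem koszulD_comp_koszulD {φ : ι → Module.End K M} (hφ : ∀ i j, Commute (φ i) (φ j))
    (m : Finset ι → M) : koszulD φ (koszulD φ m) = 0 := by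
  ext T
  simp only [koszulD_apply, map_sum, Finset.smul_sum, Pi.zero_apply, map_zsmul, smul_smul]
  rw [Finset.sum_sigma']
  refine Finset.sum_involution (fun x _ => ⟨x.2, x.1⟩) ?_ ?_ ?_ ?_
  · rintro ⟨j, k⟩ hx
    simp only [Finset.mem_sigma, Finset.mem_compl, Finset.mem_insert, not_or] at hx
    obtain ⟨hj, hkj, hk⟩ := hx
    have hc : φ k (φ j (m (insert j (insert k T)))) = φ j (φ k (m (insert j (insert k T)))) :=
      congrArg (fun f : Module.End K M => f (m (insert j (insert k T)))) (hφ k j)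
    simp only [Finset.insert_comm k j, hc]
    rw [alternatingSign_swap (Ne.symm hkj) hj hk, neg_smul, neg_add_cancel]
  · rintro ⟨j, k⟩ hx _ h
    simp only [Finset.mem_sigma, Finset.mem_compl, Finset.mem_insert, not_or] at hx
    simp only [Sigma.mk.injEq, heq_eq_eq] at h
    exact hx.2.1 h.1
  · rintro ⟨j, k⟩ hx
    simp only [Finset.mem_sigma, Finset.mem_compl, Finset.mem_insert, not_or] at hx ⊢
    exact ⟨hx.2.2, Ne.symm hx.2.1, hx.1⟩
  · rintro ⟨j, k⟩ _; rfl

/-- Koszul cycles of degree `i`. -/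
def koszulCycles (φ : ι → Module.End K M) (i : ℕ) : Submodule K (Finset ι → M) :=
  gradedPiece K (fun _ => M) i ⊓ LinearMap.ker (koszulD φ)

/-- Koszul boundaries of degree `i`: since `d` is homogeneous of degree `-1`, these are the elements
of the image of `d` that lie in degree `i`. -/
def koszulBoundaries (φ : ι → Module.End K M) (i : ℕ) : Submodule K (koszulCycles φ i) :=
  (LinearMap.range (koszulD φ)).comap (koszulCycles φ i).subtype

/-- The `i`-th Koszul homology `H_i(φ; M)` of a finite family of pairwise commuting `K`-linear
endomorphisms of `M`. -/
abbrev KoszulHomology (φ : ι → Module.End K M) (i : ℕ) : Type _ :=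
  koszulCycles φ i ⧸ koszulBoundaries φ i

end Koszul

/-! ### The partial derivatives on local cohomology of a polynomial ring -/

/-- The operators `∂_1, …, ∂_n` on the local cohomology module `H^p_I(K[X_1, …, X_n])`, where `I` is
generated by the finite sequence `a`. -/
def partialOp {K : Type*} [Field K] {n s : ℕ} (a : Fin s → MvPolynomial (Fin n) K) (p : ℕ) :
    Fin n → Module.End K (CechCohomology a p) :=
  fun i => cohomologyAction a (MvPolynomial.pderiv i) p

theorem partialOp_commute {K : Type*} [Field K] {n s : ℕ} (a : Fin s → MvPolynomial (Fin n) K)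
    (p : ℕ) (i j : Fin n) : Commute (partialOp a p i) (partialOp a p j) := by
  have h : ∀ r : MvPolynomial (Fin n) K, MvPolynomial.pderiv i (MvPolynomial.pderiv j r) =
      MvPolynomial.pderiv j (MvPolynomial.pderiv i r) := by
    let D (l : Fin n) : Derivation K (MvPolynomial (Fin n) K) (MvPolynomial (Fin n) K) :=
      MvPolynomial.pderiv l
    have h0 : ⁅D i, D j⁆ = 0 := by
      refine MvPolynomial.derivation_ext fun k => ?_
      simp [D, Derivation.commutator_apply, MvPolynomial.pderiv_X, Pi.single_apply, apply_ite]
    intro r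
    have h1 := congrArg (fun D : Derivation K (MvPolynomial (Fin n) K) (MvPolynomial (Fin n) K) => D r) h0
    simpa [D, Derivation.commutator_apply, sub_eq_zero] using h1
  refine LinearMap.ext fun x => ?_
  obtain ⟨c, rfl⟩ := Submodule.Quotient.mk_surjective _ x
  refine congrArg Submodule.Quotient.mk (Subtype.ext (funext fun S => ?_))
  exact locDerivation_comm (D := MvPolynomial.pderiv i) (E := MvPolynomial.pderiv j) h _ _

end DeRhamLC

end

/-!
Čech cohomology depends only on the radical of the ideal generated by the sequence, and compatibly
with derivations, so we may compute it with the coordinates `X (e j)` that generate `P`. There the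
top cohomology has a basis of Laurent monomials, with negative exponents in the directions of `e`
and nonnegative ones in the others. After rescaling this basis by factorials (a Fourier transform
in the directions of `e`), the module becomes a polynomial ring on which the derivative in a
direction of `e` acts as multiplication by the variable, and any other derivative as division by
the variable that discards the constant terms. Division is a left inverse of multiplication, so in
each direction the opposite operator is a homotopy for the Koszul complex. It contracts everything
except the line spanned by the constant polynomial, placed in the degree that counts the directions
outside `e`.
-/

noncomputable section

namespace DeRhamLC

section Signs

variable {ι : Type*} [LinearOrder ι]

theorem alternatingSign_mul_self (j : ι) (T : Finset ι) :
    alternatingSign j T * alternatingSign j T = 1 := by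
  rw [alternatingSign, ← pow_add, Even.neg_one_pow ⟨_, rfl⟩]

theorem alternatingSign_insert_self (j : ι) (T : Finset ι) :
    alternatingSign j (insert j T) = alternatingSign j T := by
  simp [alternatingSign, Finset.filter_insert]

theorem alternatingSign_erase_self (j : ι) (T : Finset ι) :
    alternatingSign j (T.erase j) = alternatingSign j T := by
  by_cases hj : j ∈ T
  · rw [← alternatingSign_insert_self, Finset.insert_erase hj]
  · rw [Finset.erase_eq_of_notMem hj]

theorem alternatingSign_erase_mul {i j : ι} {T : Finset ι} (hi : i ∈ T) (hj : j ∉ T) :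
    alternatingSign j (T.erase i) * alternatingSign i T =
      -(alternatingSign j T * alternatingSign i (insert j T)) := by
  have hij : i ≠ j := fun h => hj (h ▸ hi)
  have swap := alternatingSign_swap hij (Finset.notMem_erase i T)
    fun h => hj (Finset.mem_of_mem_erase h)
  rw [Finset.insert_erase hi, alternatingSign_erase_self,
    ← Finset.erase_insert_of_ne hij.symm, alternatingSign_erase_self] at swap
  have hjT := alternatingSign_mul_self j T
  have hjTi := alternatingSign_mul_self j (T.erase i)
  linear_combination (alternatingSign j (T.erase i) * alternatingSign j T) * swap -
    alternatingSign j (T.erase i) * alternatingSign i T * hjT -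
    alternatingSign j T * alternatingSign i (insert j T) * hjTi

end Signs

section ShiftSystem

variable {K M ι : Type*} [CommRing K] [AddCommGroup M] [Module K M]

/-- Commuting lowering operators `δ i` and raising operators `υ i` in independent directions, such
that `δ i` is a left inverse of `υ i`: the operators `x ^ k ↦ x ^ (k - 1)` and `x ^ k ↦ x ^ (k + 1)`
on a space with a basis of monomials. -/
structure IsShiftSystem (δ υ : ι → Module.End K M) : Prop where
  lower_commute : ∀ i k, Commute (δ i) (δ k)
  raise_commute : ∀ i k, Commute (υ i) (υ k)
  lower_raise_commute : ∀ {i k}, i ≠ k → Commute (δ i) (υ k)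
  lower_mul_raise : ∀ i, δ i * υ i = 1

/-- `IsReducedAt δ B i z` says that the components of `z` are killed by `δ i`, and that `z`
involves only those `e_T` for which `i ∈ T` exactly if `i ∈ B`. -/
def IsReducedAt (δ : ι → Module.End K M) (B : Finset ι) (i : ι) (z : Finset ι → M) : Prop :=
  ∀ T, δ i (z T) = 0 ∧ (z T ≠ 0 → (i ∈ T ↔ i ∈ B))

theorem IsShiftSystem.lower_raise_apply {δ υ : ι → Module.End K M} (h : IsShiftSystem δ υ) (i : ι)
    (x : M) : δ i (υ i x) = x :=
  LinearMap.congr_fun (h.lower_mul_raise i) x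

variable [LinearOrder ι]

/-- The degree-raising operator `m e_S ↦ ψ m e_i ∧ e_S`, which is a homotopy for the Koszul
differential. -/
def koszulHomotopy (ψ : Module.End K M) (i : ι) : Module.End K (Finset ι → M) :=
  LinearMap.pi fun T =>
    if i ∈ T then alternatingSign i T • (ψ ∘ₗ LinearMap.proj (T.erase i)) else 0

theorem koszulHomotopy_apply_of_mem (ψ : Module.End K M) {i : ι} {T : Finset ι} (hi : i ∈ T)
    (m : Finset ι → M) :
    koszulHomotopy ψ i m T = alternatingSign i T • ψ (m (T.erase i)) := by
  simp [koszulHomotopy, hi]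

theorem koszulHomotopy_apply_of_notMem (ψ : Module.End K M) {i : ι} {T : Finset ι} (hi : i ∉ T)
    (m : Finset ι → M) : koszulHomotopy ψ i m T = 0 := by
  simp [koszulHomotopy, hi]

theorem koszul_homotopy_of_notMem [Fintype ι] (φ : ι → Module.End K M) (ψ : Module.End K M) {i : ι}
    {T : Finset ι} (hi : i ∉ T) (m : Finset ι → M) :
    koszulD φ (koszulHomotopy ψ i m) T + koszulHomotopy ψ i (koszulD φ m) T =
      φ i (ψ (m T)) := by
  rw [koszulHomotopy_apply_of_notMem ψ hi, add_zero, koszulD_apply,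
    Finset.sum_eq_single_of_mem i (Finset.mem_compl.2 hi)]
  · rw [koszulHomotopy_apply_of_mem ψ (Finset.mem_insert_self i T), Finset.erase_insert hi,
      alternatingSign_insert_self, map_zsmul, smul_smul, alternatingSign_mul_self, one_smul]
  · intro j _ hji
    rw [koszulHomotopy_apply_of_notMem ψ (by simp [hi, hji.symm]), map_zero, smul_zero]

theorem koszul_homotopy_of_mem [Fintype ι] {φ : ι → Module.End K M} {ψ : Module.End K M} {i : ι}
    (hψ : ∀ j ≠ i, Commute (φ j) ψ) {T : Finset ι} (hi : i ∈ T) (m : Finset ι → M) :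
    koszulD φ (koszulHomotopy ψ i m) T + koszulHomotopy ψ i (koszulD φ m) T =
      ψ (φ i (m T)) := by
  rw [koszulHomotopy_apply_of_mem ψ hi, koszulD_apply, koszulD_apply, map_sum, Finset.smul_sum,
    Finset.compl_erase, Finset.sum_insert (Finset.notMem_compl.2 hi), add_left_comm,
    ← Finset.sum_add_distrib, Finset.sum_eq_zero, add_zero]
  · rw [Finset.insert_erase hi, map_zsmul, smul_smul, alternatingSign_erase_self,
      alternatingSign_mul_self, one_smul]
  · intro j hj
    rw [Finset.mem_compl] at hj
    have hji : j ≠ i := fun h => hj (h ▸ hi)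
    have hφψ : φ j (ψ (m (insert j (T.erase i)))) = ψ (φ j (m (insert j (T.erase i)))) :=
      LinearMap.congr_fun (hψ j hji) _
    rw [koszulHomotopy_apply_of_mem ψ (Finset.mem_insert_of_mem hi),
      Finset.erase_insert_of_ne hji, map_zsmul, map_zsmul, hφψ, smul_smul, smul_smul, ← add_smul,
      mul_comm (alternatingSign i T), alternatingSign_erase_mul hi hj, add_neg_cancel, zero_smul]

variable {δ υ : ι → Module.End K M} {B : Finset ι}

theorem koszulHomotopy_eq_zero_of_isReducedAt {i : ι} {z : Finset ι → M}
    (hz : IsReducedAt δ B i z) : koszulHomotopy (B.piecewise υ δ i) i z = 0 := by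
  funext T
  by_cases hi : i ∈ T
  · rw [koszulHomotopy_apply_of_mem _ hi, Pi.zero_apply]
    by_cases hB : i ∈ B
    · have hzero : z (T.erase i) = 0 := by
        by_contra hne
        exact Finset.notMem_erase i T (((hz _).2 hne).2 hB)
      rw [hzero, map_zero, smul_zero]
    · rw [Finset.piecewise_eq_of_notMem _ _ _ hB, (hz _).1, smul_zero]
  · exact koszulHomotopy_apply_of_notMem _ hi z

theorem koszulD_single_eq_zero [Fintype ι] (υ : ι → Module.End K M) {x : M}
    (hx : ∀ i ∈ B, δ i x = 0) :
    koszulD (B.piecewise δ υ) (Pi.single B x) = 0 := by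
  funext T
  rw [koszulD_apply, Pi.zero_apply]
  refine Finset.sum_eq_zero fun j _ => ?_
  by_cases hT : insert j T = B
  · have hj : j ∈ B := hT ▸ Finset.mem_insert_self j T
    rw [hT, Pi.single_eq_same, Finset.piecewise_eq_of_mem _ _ _ hj, hx j hj, smul_zero]
  · rw [Pi.single_eq_of_ne hT, map_zero, smul_zero]

theorem eq_single_of_isReducedAt {z : Finset ι → M} (hz : ∀ i, IsReducedAt δ B i z) :
    z = Pi.single B (z B) := by
  funext T
  by_cases hT : T = B
  · rw [hT, Pi.single_eq_same]
  · rw [Pi.single_eq_of_ne hT]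
    by_contra hne
    exact hT (Finset.ext fun i => (hz i T).2 hne)

theorem koszulD_eq_zero_of_isReducedAt [Fintype ι] (υ : ι → Module.End K M) {z : Finset ι → M}
    (hz : ∀ i, IsReducedAt δ B i z) : koszulD (B.piecewise δ υ) z = 0 := by
  rw [eq_single_of_isReducedAt hz]
  exact koszulD_single_eq_zero υ fun i _ => (hz i B).1

theorem isReducedAt_single {x : M} (hx : x ∈ ⨅ i, LinearMap.ker (δ i)) (i : ι) :
    IsReducedAt δ B i (Pi.single B x) := by
  intro T
  by_cases hT : T = B
  · subst hT
    exact ⟨by simpa using (Submodule.mem_iInf _).1 hx i, fun _ => Iff.rfl⟩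
  · simp [Pi.single_eq_of_ne hT]

namespace IsShiftSystem

theorem commute_piecewise (h : IsShiftSystem δ υ) (B : Finset ι) (i k : ι) :
    Commute (B.piecewise δ υ i) (B.piecewise δ υ k) := by
  rcases eq_or_ne i k with rfl | hik
  · exact Commute.refl _
  by_cases hi : i ∈ B <;> by_cases hk : k ∈ B <;>
    simp only [Finset.piecewise, hi, hk, if_true, if_false]
  exacts [h.lower_commute i k, h.lower_raise_commute hik, (h.lower_raise_commute hik.symm).symm,
    h.raise_commute i k]

theorem commute_piecewise_swap (h : IsShiftSystem δ υ) (B : Finset ι) {i k : ι} (hik : i ≠ k) :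
    Commute (B.piecewise δ υ i) (B.piecewise υ δ k) := by
  by_cases hi : i ∈ B <;> by_cases hk : k ∈ B <;>
    simp only [Finset.piecewise, hi, hk, if_true, if_false]
  exacts [h.lower_raise_commute hik, h.lower_commute i k, h.raise_commute i k,
    (h.lower_raise_commute hik.symm).symm]

variable [Fintype ι]

theorem koszul_homotopy_apply (h : IsShiftSystem δ υ) (B : Finset ι) (i : ι) (z : Finset ι → M)
    (T : Finset ι) :
    koszulD (B.piecewise δ υ) (koszulHomotopy (B.piecewise υ δ i) i z) T +
        koszulHomotopy (B.piecewise υ δ i) i (koszulD (B.piecewise δ υ) z) T =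
      if i ∈ T ↔ i ∈ B then υ i (δ i (z T)) else z T := by
  by_cases hT : i ∈ T
  · rw [koszul_homotopy_of_mem (fun j hj => h.commute_piecewise_swap B hj) hT]
    by_cases hB : i ∈ B <;> simp [Finset.piecewise, hT, hB, h.lower_raise_apply]
  · rw [koszul_homotopy_of_notMem _ _ hT]
    by_cases hB : i ∈ B <;> simp [Finset.piecewise, hT, hB, h.lower_raise_apply]

theorem sub_koszulD_homotopy_apply (h : IsShiftSystem δ υ) {i : ι} {z : Finset ι → M}
    (hz : IsReducedAt δ B i (koszulD (B.piecewise δ υ) z)) (T : Finset ι) :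
    (z - koszulD (B.piecewise δ υ) (koszulHomotopy (B.piecewise υ δ i) i z)) T =
      if i ∈ T ↔ i ∈ B then z T - υ i (δ i (z T)) else 0 := by
  have key := h.koszul_homotopy_apply B i z T
  rw [koszulHomotopy_eq_zero_of_isReducedAt hz, Pi.zero_apply, add_zero] at key
  rw [Pi.sub_apply, key]
  split_ifs
  exacts [rfl, sub_self _]

theorem isReducedAt_sub_koszulD_homotopy (h : IsShiftSystem δ υ) {i k : ι} {z : Finset ι → M}
    (hdz : IsReducedAt δ B i (koszulD (B.piecewise δ υ) z)) (hk : k = i ∨ IsReducedAt δ B k z) :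
    IsReducedAt δ B k
      (z - koszulD (B.piecewise δ υ) (koszulHomotopy (B.piecewise υ δ i) i z)) := by
  intro T
  rw [h.sub_koszulD_homotopy_apply hdz T]
  split_ifs with hT
  · rcases eq_or_ne k i with rfl | hki
    · exact ⟨by rw [map_sub, h.lower_raise_apply, sub_self], fun _ => hT⟩
    · obtain ⟨hker, hmem⟩ := hk.resolve_left hki T
      have hcomm : δ k (υ i (δ i (z T))) = υ i (δ i (δ k (z T))) :=
        (LinearMap.congr_fun (h.lower_raise_commute hki) _).trans
          (congrArg (υ i) (LinearMap.congr_fun (h.lower_commute k i) (z T)))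
      refine ⟨by rw [map_sub, hcomm, hker, map_zero, map_zero, sub_zero], fun hne => hmem ?_⟩
      rintro h0
      simp [h0] at hne
  · simp

theorem exists_sub_koszulD_isReducedAt (h : IsShiftSystem δ υ) (U : Finset ι) {z : Finset ι → M}
    (hz : ∀ i, IsReducedAt δ B i (koszulD (B.piecewise δ υ) z)) :
    ∃ y, (∀ i ∈ U, IsReducedAt δ B i (z - koszulD (B.piecewise δ υ) y)) ∧
      ∀ T, z T = 0 → (z - koszulD (B.piecewise δ υ) y) T = 0 := by
  induction U using Finset.induction_on with
  | empty => exact ⟨0, by simp⟩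
  | insert i U _ ih =>
    obtain ⟨y, hred, hsupp⟩ := ih
    set z' := z - koszulD (B.piecewise δ υ) y with hz'
    have hdz' : IsReducedAt δ B i (koszulD (B.piecewise δ υ) z') := by
      rw [hz', map_sub, koszulD_comp_koszulD (h.commute_piecewise B), sub_zero]
      exact hz i
    refine ⟨y + koszulHomotopy (B.piecewise υ δ i) i z', ?_⟩
    rw [map_add, ← sub_sub, ← hz']
    refine ⟨fun k hk => h.isReducedAt_sub_koszulD_homotopy hdz' ?_, fun T hT => ?_⟩
    · exact (Finset.mem_insert.1 hk).imp_right (hred k)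
    · rw [h.sub_koszulD_homotopy_apply hdz' T, hsupp T hT]
      simp

theorem exists_eq_single_add_koszulD (h : IsShiftSystem δ υ) {z : Finset ι → M}
    (hz : koszulD (B.piecewise δ υ) z = 0) :
    ∃ x ∈ ⨅ i, LinearMap.ker (δ i), ∃ y,
      z = Pi.single B x + koszulD (B.piecewise δ υ) y ∧ (z B = 0 → x = 0) := by
  obtain ⟨y, hred, hsupp⟩ := h.exists_sub_koszulD_isReducedAt (B := B) Finset.univ
    (z := z) fun i T => by simp [hz]
  have hred' := fun i => hred i (Finset.mem_univ i)
  refine ⟨_, ?_, y, sub_eq_iff_eq_add.1 (eq_single_of_isReducedAt hred'), hsupp B⟩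
  exact (Submodule.mem_iInf _).2 fun i => (hred' i B).1

theorem eq_zero_of_single_eq_koszulD (h : IsShiftSystem δ υ) {x : M}
    (hx : x ∈ ⨅ i, LinearMap.ker (δ i)) {y : Finset ι → M}
    (hxy : Pi.single B x = koszulD (B.piecewise δ υ) y) : x = 0 := by
  obtain ⟨w, hred, -⟩ := h.exists_sub_koszulD_isReducedAt (B := B) Finset.univ
    (z := y) fun i => hxy ▸ isReducedAt_single hx i
  have hd := koszulD_eq_zero_of_isReducedAt υ fun i => hred i (Finset.mem_univ i)
  rw [map_sub, koszulD_comp_koszulD (h.commute_piecewise B), sub_zero, ← hxy] at hd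
  simpa using congrFun hd B

theorem subsingleton_koszulHomology (h : IsShiftSystem δ υ) {i : ℕ} (hi : i ≠ B.card) :
    Subsingleton (KoszulHomology (B.piecewise δ υ) i) := by
  refine Submodule.Quotient.subsingleton_iff.2 (eq_top_iff.2 fun z _ => ?_)
  obtain ⟨x, -, y, hzy, hx⟩ := h.exists_eq_single_add_koszulD (LinearMap.mem_ker.1 z.2.2)
  rw [hx (z.2.1 B hi.symm), Pi.single_zero, zero_add] at hzy
  exact ⟨y, hzy.symm⟩

/-- The Koszul cycles `x e_B` for `x` killed by all lowering operators. -/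
def singleCycle (υ : ι → Module.End K M) (B : Finset ι) :
    ↥(⨅ i, LinearMap.ker (δ i)) →ₗ[K] koszulCycles (B.piecewise δ υ) B.card :=
  (LinearMap.single K (fun _ => M) B ∘ₗ Submodule.subtype _).codRestrict _ fun x =>
    ⟨fun _ hT => Pi.single_eq_of_ne (fun h => hT (congrArg Finset.card h)) _,
      koszulD_single_eq_zero υ fun i _ => (Submodule.mem_iInf _).1 x.2 i⟩

/-- The cycles `x e_B` represent the only nonzero Koszul homology, in degree `#B`. -/
def koszulHomologyEquiv (h : IsShiftSystem δ υ) (B : Finset ι) :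
    ↥(⨅ i, LinearMap.ker (δ i)) ≃ₗ[K] KoszulHomology (B.piecewise δ υ) B.card :=
  LinearEquiv.ofBijective (Submodule.mkQ _ ∘ₗ singleCycle υ B) <| by
    refine ⟨(injective_iff_map_eq_zero _).2 fun x hx => ?_, fun z => ?_⟩
    · obtain ⟨y, hy⟩ := (Submodule.Quotient.mk_eq_zero _).1 hx
      exact Subtype.ext (h.eq_zero_of_single_eq_koszulD x.2 hy.symm)
    · obtain ⟨z, rfl⟩ := Submodule.mkQ_surjective _ z
      obtain ⟨x, hx, y, hzy, -⟩ := h.exists_eq_single_add_koszulD (LinearMap.mem_ker.1 z.2.2)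
      refine ⟨⟨x, hx⟩, ((Submodule.Quotient.eq _).2 ⟨-y, ?_⟩)⟩
      rw [map_neg, neg_eq_iff_eq_neg]
      change _ = -(Pi.single B x - (z : Finset ι → M))
      rw [hzy, sub_add_cancel_left, neg_neg]

end IsShiftSystem
end ShiftSystem

section PolynomialModel

variable {K σ : Type*} [CommRing K]

open MvPolynomial

/-- Multiplication of polynomials by the variable `X i`. -/
def mulX (i : σ) : Module.End K (MvPolynomial σ K) := LinearMap.mulLeft K (X i)

/-- The quotient of polynomials by the variable `X i`, discarding the monomials that are not
divisible by it. -/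
def divX (i : σ) : Module.End K (MvPolynomial σ K) where
  toFun f := f.divMonomial (Finsupp.single i 1)
  map_add' f g := add_divMonomial f g _
  map_smul' c f := by ext α; simp

theorem coeff_divX (i : σ) (f : MvPolynomial σ K) (α : σ →₀ ℕ) :
    coeff α (divX i f) = coeff (Finsupp.single i 1 + α) f :=
  coeff_divMonomial _ f α

theorem mulX_monomial (i : σ) (α : σ →₀ ℕ) (c : K) :
    mulX i (monomial α c) = monomial (α + Finsupp.single i 1) c := by
  rw [mulX, LinearMap.mulLeft_apply, X, monomial_mul, one_mul, add_comm]

theorem divX_monomial_add_single (i : σ) (α : σ →₀ ℕ) (c : K) :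
    divX i (monomial (α + Finsupp.single i 1) c) = monomial α c := by
  classical
  ext β
  simp only [coeff_divX, coeff_monomial, add_comm α, add_right_inj]

theorem divX_monomial_of_eq_zero {i : σ} {α : σ →₀ ℕ} (hα : α i = 0) (c : K) :
    divX i (monomial α c) = 0 := by
  classical
  ext β
  rw [coeff_divX, coeff_monomial, if_neg, coeff_zero]
  rintro rfl
  simp at hα

theorem isShiftSystem_divX_mulX : IsShiftSystem (divX (K := K) (σ := σ)) mulX where
  lower_commute i k := LinearMap.ext fun f => by
    ext α
    simp only [Module.End.mul_apply, coeff_divX, add_left_comm]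
  raise_commute i k := LinearMap.ext fun f => mul_left_comm (X i) (X k) f
  lower_raise_commute {i k} hik := LinearMap.ext fun f => by
    classical
    ext α
    have hsupp : k ∈ (Finsupp.single i 1 + α).support ↔ k ∈ α.support := by simp [hik]
    simp only [mulX, Module.End.mul_apply, LinearMap.mulLeft_apply, coeff_divX, coeff_X_mul', hsupp]
    split_ifs with hk
    · rw [add_tsub_assoc_of_le]
      exact Finsupp.single_le_iff.2 (Nat.one_le_iff_ne_zero.2 (Finsupp.mem_support_iff.1 hk))
    · rfl
  lower_mul_raise i := LinearMap.ext fun f => X_mul_divMonomial i f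

theorem iInf_ker_divX :
    ⨅ i, LinearMap.ker (divX (K := K) (σ := σ) i) = LinearMap.range (Algebra.linearMap K _) := by
  ext f
  simp only [Submodule.mem_iInf, LinearMap.mem_ker, LinearMap.mem_range, Algebra.linearMap_apply,
    algebraMap_eq]
  refine ⟨fun hf => ⟨coeff 0 f, ?_⟩, ?_⟩
  · classical
    ext α
    rw [coeff_C]
    split_ifs with hα
    · rw [hα]
    · obtain ⟨i, hi⟩ := Finsupp.ne_iff.1 (Ne.symm hα)
      have hle : Finsupp.single i 1 ≤ α := Finsupp.single_le_iff.2 (Nat.one_le_iff_ne_zero.2 hi)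
      rw [← add_tsub_cancel_of_le hle, ← coeff_divX, hf i, coeff_zero]
  · rintro ⟨c, rfl⟩ i
    exact divX_monomial_of_eq_zero rfl c

/-- The polynomials killed by all `divX i` are the constants. -/
def iInfKerDivXEquiv : ↥(⨅ i, LinearMap.ker (divX (K := K) (σ := σ) i)) ≃ₗ[K] K :=
  LinearEquiv.ofEq _ _ iInf_ker_divX ≪≫ₗ
    (LinearEquiv.ofInjective (Algebra.linearMap K _) (C_injective σ K)).symm

end PolynomialModel

section Conjugacy

variable {K M M₂ M₃ ι : Type*} [CommRing K] [AddCommGroup M] [Module K M] [AddCommGroup M₂]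
  [Module K M₂] [AddCommGroup M₃] [Module K M₃]

/-- Two families of endomorphisms are conjugate if a linear equivalence intertwines them. -/
def AreConjugate (φ : ι → Module.End K M) (φ' : ι → Module.End K M₂) : Prop :=
  ∃ E : M ≃ₗ[K] M₂, ∀ i x, E (φ i x) = φ' i (E x)

variable {φ : ι → Module.End K M} {φ' : ι → Module.End K M₂} {φ'' : ι → Module.End K M₃}

theorem symm_intertwines {E : M ≃ₗ[K] M₂} (hE : ∀ i x, E (φ i x) = φ' i (E x)) (i : ι) (x : M₂) :
    E.symm (φ' i x) = φ i (E.symm x) := by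
  rw [E.symm_apply_eq, hE, E.apply_symm_apply]

theorem AreConjugate.symm : AreConjugate φ φ' → AreConjugate φ' φ :=
  fun ⟨E, hE⟩ => ⟨E.symm, symm_intertwines hE⟩

theorem AreConjugate.trans : AreConjugate φ φ' → AreConjugate φ' φ'' → AreConjugate φ φ'' := by
  rintro ⟨E, hE⟩ ⟨E', hE'⟩
  exact ⟨E ≪≫ₗ E', fun i x => by rw [LinearEquiv.trans_apply, hE, hE', LinearEquiv.trans_apply]⟩

variable [Fintype ι] [LinearOrder ι]

theorem koszulD_compLeft (f : M →ₗ[K] M₂) (hf : ∀ i x, f (φ i x) = φ' i (f x))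
    (m : Finset ι → M) : koszulD φ' (f.compLeft _ m) = f.compLeft _ (koszulD φ m) := by
  funext T
  simp only [koszulD_apply, LinearMap.compLeft_apply, Function.comp_apply, map_sum, map_zsmul, hf]

/-- Functoriality of Koszul cycles for maps that intertwine the operators. -/
def koszulCyclesMap (f : M →ₗ[K] M₂) (hf : ∀ i x, f (φ i x) = φ' i (f x)) (p : ℕ) :
    koszulCycles φ p →ₗ[K] koszulCycles φ' p :=
  (f.compLeft _).restrict fun m hm => by
    refine ⟨fun T hT => ?_, ?_⟩
    · rw [LinearMap.compLeft_apply, Function.comp_apply, hm.1 T hT, map_zero]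
    · exact (koszulD_compLeft f hf m).trans (by rw [LinearMap.mem_ker.1 hm.2, map_zero])

/-- Functoriality of Koszul homology for maps that intertwine the operators. -/
def koszulHomologyMap (f : M →ₗ[K] M₂) (hf : ∀ i x, f (φ i x) = φ' i (f x)) (p : ℕ) :
    KoszulHomology φ p →ₗ[K] KoszulHomology φ' p :=
  Submodule.mapQ _ _ (koszulCyclesMap f hf p) <| by
    rintro m ⟨y, hy⟩
    exact ⟨f.compLeft _ y, by rw [koszulD_compLeft f hf, hy]; rfl⟩

theorem AreConjugate.nonempty_koszulHomology_equiv (h : AreConjugate φ φ') (p : ℕ) :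
    Nonempty (KoszulHomology φ p ≃ₗ[K] KoszulHomology φ' p) := by
  obtain ⟨E, hE⟩ := h
  refine ⟨LinearEquiv.ofLinearMap (koszulHomologyMap E.toLinearMap hE p)
    (koszulHomologyMap E.symm.toLinearMap (symm_intertwines hE) p) ?_ ?_⟩
  · refine LinearMap.ext fun z => ?_
    obtain ⟨z, rfl⟩ := Submodule.mkQ_surjective _ z
    exact congrArg (Submodule.mkQ _) (Subtype.ext (funext fun T => E.apply_symm_apply _))
  · refine LinearMap.ext fun z => ?_
    obtain ⟨z, rfl⟩ := Submodule.mkQ_surjective _ z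
    exact congrArg (Submodule.mkQ _) (Subtype.ext (funext fun T => E.symm_apply_apply _))

end Conjugacy

section Away

variable {R A B : Type*} [CommRing R] [CommRing A] [CommRing B] [Algebra R A] [Algebra R B]
  {x y c : R}

theorem eventually_exists_map_eq_pow_smul [IsLocalization.Away x A] [IsLocalization.Away y B]
    (f : A →ₐ[R] B) (hy : y ∣ c * x) (z : B) :
    ∀ᶠ n in Filter.atTop, ∃ l, f l = c ^ n • z := by
  obtain ⟨w, hw⟩ := hy
  obtain ⟨m, r, hr⟩ := IsLocalization.Away.surj y z
  refine Filter.eventually_atTop.2 ⟨m, fun n hn => ?_⟩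
  obtain ⟨k, rfl⟩ := Nat.exists_eq_add_of_le hn
  refine ⟨c ^ k • (algebraMap R A (w ^ m * r) * IsLocalization.Away.invSelf x ^ m), ?_⟩
  have hx : algebraMap R B x * f (IsLocalization.Away.invSelf x) = 1 := by
    rw [← f.commutes, ← map_mul, IsLocalization.Away.mul_invSelf, map_one]
  have hcx : algebraMap R B y * algebraMap R B w = algebraMap R B c * algebraMap R B x := by
    rw [← map_mul, ← hw, map_mul]
  have hxm : (algebraMap R B x) ^ m * f (IsLocalization.Away.invSelf x) ^ m = 1 := by
    rw [← mul_pow, hx, one_pow]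
  have hcxm := congrArg (· ^ m) hcx
  simp only [mul_pow] at hcxm
  simp only [map_mul, map_pow, AlgHom.commutes, ← hr, Algebra.smul_def]
  linear_combination (algebraMap R B c ^ k * z * f (IsLocalization.Away.invSelf x) ^ m) * hcxm +
    algebraMap R B c ^ (m + k) * z * hxm

theorem eventually_pow_smul_eq_zero [IsLocalization.Away x A] [IsLocalization.Away y B]
    (f : A →ₐ[R] B) (hy : y ∣ c * x) {l : A} (hl : f l = 0) :
    ∀ᶠ n in Filter.atTop, c ^ n • l = 0 := by
  obtain ⟨w, hw⟩ := hy
  obtain ⟨m, r, hr⟩ := IsLocalization.Away.surj x l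
  have hr0 : algebraMap R B r = 0 := by
    rw [← f.commutes, ← hr, map_mul, hl, zero_mul]
  obtain ⟨⟨_, n₀, rfl⟩, hn₀ : y ^ n₀ * r = 0⟩ :=
    (IsLocalization.map_eq_zero_iff (Submonoid.powers y) B r).1 hr0
  refine Filter.eventually_atTop.2 ⟨n₀, fun n hn => ?_⟩
  obtain ⟨k, rfl⟩ := Nat.exists_eq_add_of_le hn
  have hx : IsUnit (algebraMap R A x) := IsLocalization.Away.algebraMap_isUnit x
  refine ((hx.pow (m + n₀)).mul_left_eq_zero).1 ?_
  have hcr : (c * x) ^ n₀ * r = 0 := by rw [hw, mul_pow, mul_right_comm, hn₀, zero_mul]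
  have hcr' := congrArg (algebraMap R A) hcr
  simp only [map_mul, map_pow, ← hr, map_zero, mul_pow] at hcr'
  rw [Algebra.smul_def, map_pow]
  linear_combination algebraMap R A c ^ k * hcr'

end Away

section CechAcyclic

variable {R : Type*} [CommRing R] {t : ℕ} (b : Fin t → R)

theorem isUnit_algebraMap_cechLoc {S : Finset (Fin t)} {j : Fin t} (hj : j ∈ S) :
    IsUnit (algebraMap R (CechLoc b S) (b j)) :=
  IsLocalization.Away.isUnit_of_dvd (∏ j ∈ S, b j) (Finset.dvd_prod_of_mem b hj)

theorem eq_zero_of_pow_smul_eq_zero {S : Finset (Fin t)} {j : Fin t} (hj : j ∈ S) {n : ℕ}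
    {z : CechLoc b S} (hz : b j ^ n • z = 0) : z = 0 := by
  rw [Algebra.smul_def, map_pow] at hz
  exact (((isUnit_algebraMap_cechLoc b hj).pow n).mul_right_eq_zero).1 hz

theorem exists_pow_smul_eq {S : Finset (Fin t)} {j : Fin t} (hj : j ∈ S) (n : ℕ)
    (z : CechLoc b S) : ∃ y : CechLoc b S, b j ^ n • y = z := by
  obtain ⟨u, hu⟩ := (isUnit_algebraMap_cechLoc b hj).pow n
  exact ⟨↑u⁻¹ * z, by rw [Algebra.smul_def, map_pow, ← hu, Units.mul_inv_cancel_left]⟩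

/-- The component `c_S` of a Čech cochain in `R_{b_U}`, with value `0` unless `S ⊆ U`. Taking `U`
and `S` to be independent avoids transport along equalities of index sets. -/
def restrictTo (U S : Finset (Fin t)) : CechCochain b →ₗ[R] CechLoc b U :=
  if h : S ⊆ U then (cechRestrict b h).toLinearMap ∘ₗ LinearMap.proj S else 0

theorem restrictTo_of_subset {S U : Finset (Fin t)} (h : S ⊆ U) (c : CechCochain b) :
    restrictTo b U S c = cechRestrict b h (c S) := by
  simp [restrictTo, h]

theorem restrictTo_self (S : Finset (Fin t)) (c : CechCochain b) : restrictTo b S S c = c S := by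
  have hid : cechRestrict b (Finset.Subset.refl S) = AlgHom.id R (CechLoc b S) :=
    (IsLocalization.algHom_subsingleton (Submonoid.powers (∏ j ∈ S, b j))).elim _ _
  rw [restrictTo_of_subset b (Finset.Subset.refl S), hid, AlgHom.id_apply]

theorem restrictTo_eq_zero {S : Finset (Fin t)} (U : Finset (Fin t)) {c : CechCochain b}
    (h : c S = 0) : restrictTo b U S c = 0 := by
  by_cases hS : S ⊆ U
  · rw [restrictTo_of_subset b hS, h, map_zero]
  · simp [restrictTo, hS]

theorem cechRestrict_restrictTo {S U V : Finset (Fin t)} (hS : S ⊆ U) (hU : U ⊆ V)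
    (c : CechCochain b) : cechRestrict b hU (restrictTo b U S c) = restrictTo b V S c := by
  rw [restrictTo_of_subset b hS, restrictTo_of_subset b (hS.trans hU), cechRestrict_comp]

theorem restrictTo_cechD {T U : Finset (Fin t)} (h : T ⊆ U) (c : CechCochain b) :
    restrictTo b U T (cechD b c) =
      ∑ j ∈ T, (alternatingSign j T : R) • restrictTo b U (T.erase j) c := by
  rw [restrictTo_of_subset b h, cechD_apply, map_sum]
  refine Finset.sum_congr rfl fun j _ => ?_
  rw [map_zsmul, cechRestrict_comp, restrictTo_of_subset, Int.cast_smul_eq_zsmul]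

theorem cechD_apply_eq_sum_restrictTo (c : CechCochain b) (T : Finset (Fin t)) :
    cechD b c T = ∑ j ∈ T, (alternatingSign j T : R) • restrictTo b T (T.erase j) c := by
  rw [← restrictTo_cechD b (Finset.Subset.refl T), restrictTo_self]

/-- The Čech cochains that vanish on all subsets of `V`: the kernel of the restriction to the
subsequence of `b` indexed by `V`. -/
def cechVanishing (V : Finset (Fin t)) : Submodule R (CechCochain b) where
  carrier := {c | ∀ T ⊆ V, c T = 0}
  add_mem' hx hy T hT := by rw [Pi.add_apply, hx T hT, hy T hT, add_zero]
  zero_mem' _ _ := rfl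
  smul_mem' r c hc T hT := by rw [Pi.smul_apply, hc T hT, smul_zero]

variable {b} {V : Finset (Fin t)}

theorem cechD_mem_cechVanishing {c : CechCochain b} (hc : c ∈ cechVanishing b V) :
    cechD b c ∈ cechVanishing b V := by
  intro T hT
  rw [cechD_apply_eq_sum_restrictTo]
  refine Finset.sum_eq_zero fun j _ => ?_
  rw [restrictTo_eq_zero b T (hc _ ((Finset.erase_subset j T).trans hT)), smul_zero]

theorem restrictTo_eq_sum_of_cocycle {w : CechCochain b} (hw : cechD b w = 0) {j : Fin t}
    {T : Finset (Fin t)} (hj : j ∉ T) :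
    restrictTo b (insert j T) T w = ∑ i ∈ T,
      (alternatingSign i T * alternatingSign j (T.erase i) : R) •
        restrictTo b (insert j T) (insert j (T.erase i)) w := by
  have hsum := restrictTo_cechD b (Finset.Subset.refl (insert j T)) w
  rw [restrictTo_self, hw, Pi.zero_apply, Finset.sum_insert hj, Finset.erase_insert hj,
    alternatingSign_insert_self] at hsum
  have hsq : (alternatingSign j T * alternatingSign j T : R) = 1 := by
    exact_mod_cast congrArg (Int.cast (R := R)) (alternatingSign_mul_self j T)
  rw [← one_smul R (restrictTo b (insert j T) T w), ← hsq, mul_smul,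
    eq_neg_of_add_eq_zero_left hsum.symm, smul_neg, Finset.smul_sum, ← Finset.sum_neg_distrib]
  refine Finset.sum_congr rfl fun i hi => ?_
  have hij : j ≠ i := fun h => hj (h ▸ hi)
  have hsign : (alternatingSign j (T.erase i) * alternatingSign i T : R) =
      -(alternatingSign j T * alternatingSign i (insert j T)) := by
    exact_mod_cast congrArg (Int.cast (R := R)) (alternatingSign_erase_mul hi hj)
  rw [Finset.erase_insert_of_ne hij, mul_comm (alternatingSign i T : R), hsign, neg_smul, mul_smul]

theorem restrictTo_cechD_of_contraction {w g : CechCochain b} (hw : cechD b w = 0) {j : Fin t}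
    {r : R} (hg_mem : ∀ S, j ∈ S → g S = 0)
    (hg : ∀ S, j ∉ S → restrictTo b (insert j S) S g =
      r • (alternatingSign j S : R) • w (insert j S)) (T : Finset (Fin t)) :
    restrictTo b (insert j T) T (cechD b g) = r • restrictTo b (insert j T) T w := by
  have hg' : ∀ S ⊆ T, j ∉ S → restrictTo b (insert j T) S g =
      r • (alternatingSign j S : R) • restrictTo b (insert j T) (insert j S) w := by
    intro S hST hS
    rw [← cechRestrict_restrictTo b (Finset.subset_insert j S) (Finset.insert_subset_insert j hST),
      hg S hS, map_smul, map_smul, restrictTo_of_subset]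
  rw [restrictTo_cechD b (Finset.subset_insert j T)]
  by_cases hj : j ∈ T
  · have hsq : (alternatingSign j T * alternatingSign j T : R) = 1 := by
      exact_mod_cast congrArg (Int.cast (R := R)) (alternatingSign_mul_self j T)
    rw [Finset.sum_eq_single_of_mem j hj, hg' _ (Finset.erase_subset j T) (Finset.notMem_erase j T),
      Finset.insert_erase hj, alternatingSign_erase_self, smul_comm _ r,
      smul_smul _ _ (restrictTo _ _ _ _), hsq, one_smul]
    intro i _ hij
    rw [restrictTo_eq_zero b _ (hg_mem _ (Finset.mem_erase.2 ⟨hij.symm, hj⟩)), smul_zero]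
  · rw [restrictTo_eq_sum_of_cocycle hw hj, Finset.smul_sum]
    refine Finset.sum_congr rfl fun i _ => ?_
    rw [hg' _ (Finset.erase_subset i T) fun h => hj (Finset.mem_of_mem_erase h),
      mul_smul, smul_comm _ r]

theorem prod_insert_dvd (b : Fin t → R) (j : Fin t) (S : Finset (Fin t)) :
    ∏ i ∈ insert j S, b i ∣ b j * ∏ i ∈ S, b i := by
  by_cases hj : j ∈ S
  · rw [Finset.insert_eq_of_mem hj]
    exact dvd_mul_left _ _
  · rw [Finset.prod_insert hj]

-- Up to signs, `w ↦ (S ↦ w (insert j S))` is a contracting homotopy once `b j` is inverted;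
-- `b j ^ n` clears the denominators.
theorem exists_contraction {w : CechCochain b} (hw : w ∈ cechVanishing b V) {j : Fin t}
    (hj : j ∈ V) : ∃ n, ∃ g ∈ cechVanishing b V, (∀ S, j ∈ S → g S = 0) ∧
      ∀ S, j ∉ S → restrictTo b (insert j S) S g =
        b j ^ n • (alternatingSign j S : R) • w (insert j S) := by
  classical
  have hlift : ∀ S, ∀ᶠ n in Filter.atTop, ∃ l, cechRestrict b (Finset.subset_insert j S) l =
      b j ^ n • (alternatingSign j S : R) • w (insert j S) := fun S =>
    eventually_exists_map_eq_pow_smul (x := ∏ i ∈ S, b i) (y := ∏ i ∈ insert j S, b i) _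
      (prod_insert_dvd b j S) _
  obtain ⟨n, hn⟩ := (Filter.eventually_all.2 hlift).exists
  choose l hl using hn
  refine ⟨n, fun S => if j ∈ S ∨ S ⊆ V then 0 else l S, fun S hS => if_pos (Or.inr hS),
    fun S hS => if_pos (Or.inl hS), fun S hS => ?_⟩
  by_cases hSV : S ⊆ V
  · rw [restrictTo_eq_zero b _ (if_pos (Or.inr hSV)), hw _ (Finset.insert_subset hj hSV), smul_zero,
      smul_zero]
  · rw [restrictTo_of_subset b (Finset.subset_insert j S), if_neg (by tauto), hl]

theorem exists_cechD_eq_pow_smul {w : CechCochain b} (hw : w ∈ cechVanishing b V)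
    (hdw : cechD b w = 0) {j : Fin t} (hj : j ∈ V) :
    ∃ n, ∃ u ∈ cechVanishing b V, cechD b u = b j ^ n • w := by
  obtain ⟨n, g, hgV, hg_mem, hg⟩ := exists_contraction hw hj
  have hkill : ∀ T, ∀ᶠ m in Filter.atTop, b j ^ m • (cechD b g - b j ^ n • w) T = 0 := fun T => by
    refine eventually_pow_smul_eq_zero (x := ∏ i ∈ T, b i) (y := ∏ i ∈ insert j T, b i)
      (cechRestrict b (Finset.subset_insert j T)) (prod_insert_dvd b j T) ?_
    rw [← restrictTo_of_subset, map_sub, map_smul,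
      restrictTo_cechD_of_contraction hdw hg_mem hg T, sub_self]
  obtain ⟨m, hm⟩ := (Filter.eventually_all.2 hkill).exists
  refine ⟨m + n, b j ^ m • g, Submodule.smul_mem _ _ hgV, ?_⟩
  rw [map_smul, pow_add, mul_smul, ← sub_eq_zero, ← smul_sub]
  exact funext hm

theorem exists_pow_smul_mem_of_mem_radical {w : CechCochain b} (hw : w ∈ cechVanishing b V)
    (hdw : cechD b w = 0) {r : R} (hr : r ∈ (Ideal.span (b '' V)).radical) :
    ∃ n, r ^ n • w ∈ (cechVanishing b V).map (cechD b) := by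
  let J : Ideal R := ((cechVanishing b V).map (cechD b)).comap (LinearMap.toSpanSingleton R _ w)
  have hspan : Ideal.span (b '' V) ≤ J.radical := by
    refine Ideal.span_le.2 ?_
    rintro _ ⟨j, hj, rfl⟩
    obtain ⟨n, u, hu, hdu⟩ := exists_cechD_eq_pow_smul hw hdw hj
    exact ⟨n, u, hu, hdu⟩
  exact Ideal.radical_le_radical_iff.2 hspan hr

-- `b k` is invertible on the components whose index contains `k`, so there a primitive of
-- `b k ^ n • w` can be divided by `b k ^ n`; the other components of `w` on subsets of
-- `insert k V` vanish already.
theorem exists_sub_cechD_mem_insert {w : CechCochain b} (hw : w ∈ cechVanishing b V)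
    (hdw : cechD b w = 0) {k : Fin t} (hk : b k ∈ (Ideal.span (b '' V)).radical) :
    ∃ u ∈ cechVanishing b V, w - cechD b u ∈ cechVanishing b (insert k V) := by
  by_cases hkV : k ∈ V
  · exact ⟨0, Submodule.zero_mem _, by rwa [map_zero, sub_zero, Finset.insert_eq_of_mem hkV]⟩
  obtain ⟨n, u, hu, hdu⟩ := exists_pow_smul_mem_of_mem_radical hw hdw hk
  have hdiv : ∀ T, ∃ y : CechLoc b T, if k ∈ T then b k ^ n • y = u T else y = 0 := fun T => by
    split_ifs with hkT
    exacts [exists_pow_smul_eq b hkT n (u T), ⟨0, rfl⟩]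
  choose v hv using hdiv
  have hvV : v ∈ cechVanishing b V := fun T hT =>
    (if_neg fun h => hkV (hT h)).mp (hv T)
  have hvu : b k ^ n • v - u ∈ cechVanishing b (insert k V) := fun T hT => by
    by_cases hkT : k ∈ T
    · rw [Pi.sub_apply, Pi.smul_apply, (if_pos hkT).mp (hv T), sub_self]
    · have hTV := (Finset.subset_insert_iff_of_notMem hkT).1 hT
      rw [Pi.sub_apply, Pi.smul_apply, hvV T hTV, hu T hTV, smul_zero, sub_zero]
  have hdvu : b k ^ n • (w - cechD b v) ∈ cechVanishing b (insert k V) := by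
    rw [smul_sub, ← hdu, ← map_smul, ← map_sub, ← neg_sub, map_neg]
    exact Submodule.neg_mem _ (cechD_mem_cechVanishing hvu)
  refine ⟨v, hvV, fun T hT => ?_⟩
  by_cases hkT : k ∈ T
  · exact eq_zero_of_pow_smul_eq_zero b hkT (hdvu T hT)
  · exact Submodule.sub_mem _ hw (cechD_mem_cechVanishing hvV) T
      ((Finset.subset_insert_iff_of_notMem hkT).1 hT)

theorem cechVanishing_anti {U : Finset (Fin t)} (hUV : U ⊆ V) :
    cechVanishing b V ≤ cechVanishing b U := fun _ hc T hT => hc T (hT.trans hUV)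

theorem exists_sub_cechD_mem_union {U : Finset (Fin t)}
    (hb : ∀ k, b k ∈ (Ideal.span (b '' U)).radical) (W : Finset (Fin t)) {w : CechCochain b}
    (hw : w ∈ cechVanishing b U) (hdw : cechD b w = 0) :
    ∃ u ∈ cechVanishing b U, w - cechD b u ∈ cechVanishing b (W ∪ U) := by
  induction W using Finset.induction_on with
  | empty => exact ⟨0, Submodule.zero_mem _, by simpa using hw⟩
  | insert k W _ ih =>
    obtain ⟨u, hu, hwu⟩ := ih
    have hk : b k ∈ (Ideal.span (b '' ↑(W ∪ U))).radical :=
      Ideal.radical_mono (Ideal.span_mono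
        (Set.image_mono (Finset.coe_subset.2 Finset.subset_union_right))) (hb k)
    obtain ⟨v, hv, hwv⟩ := exists_sub_cechD_mem_insert hwu
      (by rw [map_sub, cechD_comp_cechD, hdw, sub_zero]) hk
    refine ⟨u + v, Submodule.add_mem _ hu (cechVanishing_anti Finset.subset_union_right hv), ?_⟩
    rwa [map_add, ← sub_sub, Finset.insert_union]

theorem exists_cechD_eq_of_mem_cechVanishing {U : Finset (Fin t)}
    (hb : ∀ k, b k ∈ (Ideal.span (b '' U)).radical) {w : CechCochain b}
    (hw : w ∈ cechVanishing b U) (hdw : cechD b w = 0) :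
    ∃ u ∈ cechVanishing b U, cechD b u = w := by
  obtain ⟨u, hu, hwu⟩ := exists_sub_cechD_mem_union hb Finset.univ hw hdw
  exact ⟨u, hu, (sub_eq_zero.1 (funext fun T => hwu T <|
    (Finset.subset_univ T).trans Finset.subset_union_left)).symm⟩

end CechAcyclic

section CechSubsequence

variable {R : Type*} [CommRing R]

/-- The localization map `R_x → R_y` when `x` divides `y`. -/
def awayHom {x y : R} (h : x ∣ y) : Localization.Away x →ₐ[R] Localization.Away y :=
  IsLocalization.Away.liftAlgHom x (f := Algebra.ofId R (Localization.Away y))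
    (IsLocalization.Away.isUnit_of_dvd (S := Localization.Away y) y h)

theorem algHom_away_ext {A : Type*} [CommRing A] [Algebra R A] {x : R}
    (f g : Localization.Away x →ₐ[R] A) : f = g :=
  (IsLocalization.algHom_subsingleton (Submonoid.powers x)).elim f g

theorem awayHom_awayHom {x y z : R} (h : x ∣ y) (h' : y ∣ z) (u : Localization.Away x) :
    awayHom h' (awayHom h u) = awayHom (h.trans h') u :=
  DFunLike.congr_fun (algHom_away_ext ((awayHom h').comp (awayHom h)) (awayHom (h.trans h'))) u

theorem awayHom_self {x : R} (h : x ∣ x) (u : Localization.Away x) : awayHom h u = u :=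
  DFunLike.congr_fun (algHom_away_ext (awayHom h) (AlgHom.id R _)) u

section Truncation

variable {t : ℕ} (b : Fin t → R)

/-- The homogeneous component of degree `p` of a Čech cochain. -/
def cechTrunc (p : ℕ) (c : CechCochain b) : CechCochain b :=
  fun S => if S.card = p then c S else 0

theorem cechTrunc_mem_gradedPiece (p : ℕ) (c : CechCochain b) :
    cechTrunc b p c ∈ gradedPiece R (CechLoc b) p := fun _ hS => if_neg hS

theorem cechTrunc_of_mem_gradedPiece {p : ℕ} {c : CechCochain b}
    (hc : c ∈ gradedPiece R (CechLoc b) p) : cechTrunc b p c = c :=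
  funext fun S => ite_eq_left_iff.2 fun hS => (hc S hS).symm

theorem cechD_cechTrunc (p : ℕ) (c : CechCochain b) :
    cechD b (cechTrunc b p c) = cechTrunc b (p + 1) (cechD b c) := by
  funext T
  have hcard : ∀ j ∈ T, ((T.erase j).card = p ↔ T.card = p + 1) := fun j hj => by
    rw [← Finset.card_erase_add_one hj, Nat.add_right_cancel_iff]
  rw [cechD_apply_eq_sum_restrictTo]
  unfold cechTrunc
  split_ifs with hT
  · rw [cechD_apply_eq_sum_restrictTo]
    refine Finset.sum_congr rfl fun j hj => ?_
    rw [restrictTo_of_subset b (Finset.erase_subset j T), if_pos ((hcard j hj).2 hT),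
      restrictTo_of_subset b (Finset.erase_subset j T)]
  · refine Finset.sum_eq_zero fun j hj => ?_
    rw [restrictTo_eq_zero b T (if_neg (mt (hcard j hj).1 hT)), smul_zero]

end Truncation

variable {s t : ℕ} (b : Fin t → R) (e : Fin s ↪o Fin t)

theorem alternatingSign_map (j : Fin s) (S : Finset (Fin s)) :
    alternatingSign (e j) (S.map e.toEmbedding) = alternatingSign j S := by
  simp only [alternatingSign, Finset.filter_map, Finset.card_map, Function.comp_def,
    RelEmbedding.coe_toEmbedding, OrderEmbedding.lt_iff_lt]

theorem cechRestrict_eq_awayHom {S T : Finset (Fin t)} (h : S ⊆ T) (u : CechLoc b S) :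
    cechRestrict b h u = awayHom (Finset.prod_dvd_prod_of_subset S T b h) u := rfl

theorem prod_comp_orderEmb (S : Finset (Fin s)) :
    ∏ j ∈ S, (b ∘ e) j = ∏ j ∈ S.map e.toEmbedding, b j :=
  (Finset.prod_map S e.toEmbedding b).symm

theorem awayHom_apply_congr (c : CechCochain b) {U V : Finset (Fin t)} (h : U = V) {y : R}
    (hU : ∏ j ∈ U, b j ∣ y) (hV : ∏ j ∈ V, b j ∣ y) : awayHom hU (c U) = awayHom hV (c V) := by
  subst h
  rfl

/-- The restriction of Čech cochains to the subsequence `b ∘ e` of `b`. -/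
def cechPull : CechCochain b →ₗ[R] CechCochain (b ∘ e) :=
  LinearMap.pi fun S => (awayHom (prod_comp_orderEmb b e S).symm.dvd).toLinearMap ∘ₗ
    LinearMap.proj (S.map e.toEmbedding)

theorem cechPull_apply (c : CechCochain b) (S : Finset (Fin s)) :
    cechPull b e c S = awayHom (prod_comp_orderEmb b e S).symm.dvd (c (S.map e.toEmbedding)) :=
  rfl

theorem cechPull_cechD (c : CechCochain b) :
    cechPull b e (cechD b c) = cechD (b ∘ e) (cechPull b e c) := by
  funext S
  rw [cechPull_apply, cechD_apply, cechD_apply, map_sum, Finset.sum_map]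
  refine Finset.sum_congr rfl fun j _ => ?_
  have hsign := alternatingSign_map e j S
  have herase : (S.map e.toEmbedding).erase (e.toEmbedding j) = (S.erase j).map e.toEmbedding :=
    (Finset.map_erase _ _ _).symm
  rw [map_zsmul, cechPull_apply]
  refine congrArg₂ _ hsign ?_
  rw [cechRestrict_eq_awayHom, cechRestrict_eq_awayHom, awayHom_awayHom, awayHom_awayHom]
  exact awayHom_apply_congr b c herase _ _

theorem ker_cechPull :
    LinearMap.ker (cechPull b e) = cechVanishing b (Finset.univ.map e.toEmbedding) := by
  refine le_antisymm (fun c hc T hT => ?_) fun c hc => funext fun S => ?_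
  · obtain ⟨S, -, rfl⟩ := Finset.subset_map_iff.1 hT
    have hS := congrArg (awayHom (prod_comp_orderEmb b e S).dvd) (congrFun hc S)
    rwa [cechPull_apply, awayHom_awayHom, awayHom_self, Pi.zero_apply, map_zero] at hS
  · rw [cechPull_apply, hc _ (Finset.map_subset_map.2 (Finset.subset_univ S)), map_zero,
      Pi.zero_apply]

theorem cechPull_surjective : Function.Surjective (cechPull b e) := by
  intro c
  have hdvd : ∀ T : Finset (Fin t), ∏ j with e j ∈ T, (b ∘ e) j ∣ ∏ j ∈ T, b j := fun T => by
    rw [prod_comp_orderEmb]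
    refine Finset.prod_dvd_prod_of_subset _ _ _ (Finset.map_subset_iff_subset_preimage.2 ?_)
    intro j hj
    simpa using hj
  refine ⟨fun T => awayHom (hdvd T) (c _), funext fun S => ?_⟩
  have hS : ({j | e j ∈ S.map e.toEmbedding} : Finset (Fin s)) = S := by ext i; simp
  rw [cechPull_apply, awayHom_awayHom, awayHom_apply_congr (b ∘ e) c hS _ dvd_rfl, awayHom_self]

theorem cechPull_cechTrunc (p : ℕ) (c : CechCochain b) :
    cechPull b e (cechTrunc b p c) = cechTrunc (b ∘ e) p (cechPull b e c) := by
  funext S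
  rw [cechPull_apply, cechTrunc, cechTrunc, Finset.card_map,
    apply_ite (awayHom (prod_comp_orderEmb b e S).symm.dvd), map_zero, cechPull_apply]

theorem cechPull_mem_cechCocycles {p : ℕ} {c : CechCochain b} (hc : c ∈ cechCocycles b p) :
    cechPull b e c ∈ cechCocycles (b ∘ e) p := by
  refine ⟨fun S hS => ?_, LinearMap.mem_ker.2 ?_⟩
  · rw [cechPull_apply, hc.1 _ (by rwa [Finset.card_map]), map_zero]
  · rw [← cechPull_cechD, LinearMap.mem_ker.1 hc.2, map_zero]

/-- The restriction of Čech cocycles to the subsequence `b ∘ e` of `b`. -/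
def cocyclePull (p : ℕ) : cechCocycles b p →ₗ[R] cechCocycles (b ∘ e) p :=
  (cechPull b e).restrict fun _ hc => cechPull_mem_cechCocycles b e hc

theorem cechCoboundaries_le_comap_cocyclePull (p : ℕ) :
    cechCoboundaries b p ≤ (cechCoboundaries (b ∘ e) p).comap (cocyclePull b e p) := by
  rintro c ⟨y, hy⟩
  exact ⟨cechPull b e y, by rw [← cechPull_cechD, hy]; rfl⟩

/-- The map that restriction to the subsequence `b ∘ e` of `b` induces on Čech cohomology. -/
def cohomologyPull (p : ℕ) : CechCohomology b p →ₗ[R] CechCohomology (b ∘ e) p :=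
  (cechCoboundaries b p).mapQ (cechCoboundaries (b ∘ e) p) (cocyclePull b e p)
    (cechCoboundaries_le_comap_cocyclePull b e p)

theorem cohomologyPull_mk {p : ℕ} (c : cechCocycles b p) :
    cohomologyPull b e p (Submodule.Quotient.mk c) = Submodule.Quotient.mk (cocyclePull b e p c) :=
  rfl

theorem cohomologyPull_cohomologyAction {K : Type*} [CommRing K] [Algebra K R]
    (D : Derivation K R R) (p : ℕ) (x : CechCohomology b p) :
    cohomologyPull b e p (cohomologyAction b D p x) =
      cohomologyAction (b ∘ e) D p (cohomologyPull b e p x) := by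
  obtain ⟨c, rfl⟩ := Submodule.Quotient.mk_surjective _ x
  refine congrArg Submodule.Quotient.mk (Subtype.ext (funext fun S => ?_))
  exact locDerivation_map D (awayHom (prod_comp_orderEmb b e S).symm.dvd) _

variable {b e}

theorem exists_cechD_eq_of_cechPull_eq_zero
    (hb : ∀ k, b k ∈ (Ideal.span (Set.range (b ∘ e))).radical) {w : CechCochain b}
    (hw : cechPull b e w = 0) (hdw : cechD b w = 0) :
    ∃ u, cechPull b e u = 0 ∧ cechD b u = w := by
  have himage : b '' (Finset.univ.map e.toEmbedding : Finset (Fin t)) = Set.range (b ∘ e) := by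
    rw [Finset.coe_map, Finset.coe_univ, Set.image_univ, ← Set.range_comp]
    rfl
  rw [← LinearMap.mem_ker, ker_cechPull] at hw
  obtain ⟨u, hu, hdu⟩ := exists_cechD_eq_of_mem_cechVanishing (himage ▸ hb) hw hdw
  exact ⟨u, by rwa [← LinearMap.mem_ker, ker_cechPull], hdu⟩

theorem cohomologyPull_injective (hb : ∀ k, b k ∈ (Ideal.span (Set.range (b ∘ e))).radical)
    (p : ℕ) : Function.Injective (cohomologyPull b e p) := by
  refine (injective_iff_map_eq_zero _).2 fun x hx => ?_
  obtain ⟨c, rfl⟩ := Submodule.Quotient.mk_surjective _ x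
  rw [cohomologyPull_mk, Submodule.Quotient.mk_eq_zero] at hx
  obtain ⟨y, hy⟩ := hx
  obtain ⟨y, rfl⟩ := cechPull_surjective b e y
  obtain ⟨u, -, hu⟩ := exists_cechD_eq_of_cechPull_eq_zero hb (w := c.1 - cechD b y)
    (by rw [map_sub, cechPull_cechD, hy]; exact sub_self _)
    (by rw [map_sub, cechD_comp_cechD, LinearMap.mem_ker.1 c.2.2, sub_zero])
  rw [Submodule.Quotient.mk_eq_zero]
  exact ⟨u + y, by rw [map_add, hu, sub_add_cancel]; rfl⟩

theorem cocyclePull_surjective (hb : ∀ k, b k ∈ (Ideal.span (Set.range (b ∘ e))).radical)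
    (p : ℕ) : Function.Surjective (cocyclePull b e p) := by
  intro c
  obtain ⟨z, hz⟩ := cechPull_surjective b e c.1
  obtain ⟨u, hu, hdu⟩ := exists_cechD_eq_of_cechPull_eq_zero hb (w := cechD b z)
    (by rw [cechPull_cechD, hz, LinearMap.mem_ker.1 c.2.2]) (cechD_comp_cechD b z)
  have hcocycle : cechD b (cechTrunc b p (z - u)) = 0 := by
    rw [cechD_cechTrunc, map_sub, hdu, sub_self]
    exact cechTrunc_of_mem_gradedPiece b (Submodule.zero_mem _)
  refine ⟨⟨_, cechTrunc_mem_gradedPiece b p (z - u), hcocycle⟩, Subtype.ext ?_⟩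
  change cechPull b e (cechTrunc b p (z - u)) = c.1
  rw [cechPull_cechTrunc, map_sub, hz, hu, sub_zero, cechTrunc_of_mem_gradedPiece _ c.2.1]

theorem cohomologyPull_surjective (hb : ∀ k, b k ∈ (Ideal.span (Set.range (b ∘ e))).radical)
    (p : ℕ) : Function.Surjective (cohomologyPull b e p) := by
  intro y
  obtain ⟨c, rfl⟩ := Submodule.Quotient.mk_surjective _ y
  obtain ⟨c, rfl⟩ := cocyclePull_surjective hb p c
  exact ⟨Submodule.Quotient.mk c, rfl⟩

variable {K ι : Type*} [CommRing K] [Algebra K R] (D : ι → Derivation K R R) (p : ℕ)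

theorem areConjugate_cohomologyAction_comp
    (hb : ∀ k, b k ∈ (Ideal.span (Set.range (b ∘ e))).radical) :
    AreConjugate (fun k => cohomologyAction b (D k) p)
      fun k => cohomologyAction (b ∘ e) (D k) p :=
  ⟨(LinearEquiv.ofBijective (cohomologyPull b e p)
      ⟨cohomologyPull_injective hb p, cohomologyPull_surjective hb p⟩).restrictScalars K,
    fun k => cohomologyPull_cohomologyAction b e (D k) p⟩

theorem areConjugate_cohomologyAction {a : Fin s → R} {a' : Fin t → R}
    (h : (Ideal.span (Set.range a)).radical = (Ideal.span (Set.range a')).radical) :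
    AreConjugate (fun k => cohomologyAction a (D k) p) fun k => cohomologyAction a' (D k) p := by
  have hleft : Fin.append a a' ∘ Fin.castAddOrderEmb t = a := funext (Fin.append_left a a')
  have hright : Fin.append a a' ∘ Fin.natAddOrderEmb s = a' := funext (Fin.append_right a a')
  have hmem : ∀ k, Fin.append a a' k ∈ (Ideal.span (Set.range a)).radical := by
    refine Fin.addCases (fun i => ?_) fun j => ?_
    · rw [Fin.append_left]
      exact Ideal.le_radical (Ideal.subset_span ⟨i, rfl⟩)
    · rw [Fin.append_right, h]
      exact Ideal.le_radical (Ideal.subset_span ⟨j, rfl⟩)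
  have hconj := areConjugate_cohomologyAction_comp (b := Fin.append a a')
    (e := Fin.castAddOrderEmb t) D p (by rwa [hleft])
  have hconj' := areConjugate_cohomologyAction_comp (b := Fin.append a a')
    (e := Fin.natAddOrderEmb s) D p (by rwa [hright, ← h])
  rw [hleft] at hconj
  rw [hright] at hconj'
  exact hconj.symm.trans hconj'

end CechSubsequence

section TopCech

variable {R : Type*} [CommRing R] {m : ℕ} (a : Fin m → R)

theorem single_univ_mem_cechCocycles (z : CechLoc a Finset.univ) :
    LinearMap.single R (CechLoc a) Finset.univ z ∈ cechCocycles a m := by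
  refine ⟨fun S hS => Pi.single_eq_of_ne (fun h => hS (by simp [h])) z,
    LinearMap.mem_ker.2 (funext fun T => ?_)⟩
  rw [cechD_apply_eq_sum_restrictTo]
  refine Finset.sum_eq_zero fun j _ => ?_
  have hne : T.erase j ≠ Finset.univ := fun h => Finset.notMem_erase j T (h ▸ Finset.mem_univ j)
  exact (congrArg _ (restrictTo_eq_zero a T (Pi.single_eq_of_ne hne z))).trans (smul_zero _)

/-- The map from `R_{a_1 ⋯ a_m}` onto the top Čech cohomology. -/
def topClass : CechLoc a Finset.univ →ₗ[R] CechCohomology a m :=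
  (cechCoboundaries a m).mkQ ∘ₗ
    (LinearMap.single R (CechLoc a) Finset.univ).codRestrict _ (single_univ_mem_cechCocycles a)

theorem topClass_surjective : Function.Surjective (topClass a) := by
  intro x
  obtain ⟨c, rfl⟩ := Submodule.Quotient.mk_surjective _ x
  refine ⟨c.1 Finset.univ, congrArg Submodule.Quotient.mk (Subtype.ext (funext fun S => ?_))⟩
  by_cases hS : S = Finset.univ
  · subst hS
    exact Pi.single_eq_same _ _
  · exact (Pi.single_eq_of_ne hS _).trans
      (c.2.1 S fun h => hS (Finset.eq_univ_of_card S (by simpa using h))).symm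

theorem cohomologyAction_topClass {K : Type*} [CommRing K] [Algebra K R] (D : Derivation K R R)
    (z : CechLoc a Finset.univ) :
    cohomologyAction a D m (topClass a z) = topClass a (locDerivation D _ z) := by
  refine congrArg Submodule.Quotient.mk (Subtype.ext (funext fun S => ?_))
  exact Pi.apply_single (fun S => locDerivation D (Submonoid.powers (∏ j ∈ S, a j)))
    (fun _ => map_zero _) Finset.univ z S

theorem topClass_eq_zero_iff {z : CechLoc a Finset.univ} :
    topClass a z = 0 ↔ ∃ y, cechD a y = Pi.single Finset.univ z :=
  Submodule.Quotient.mk_eq_zero _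

theorem eq_univ_and_eq_of_erase_eq {ι : Type*} [Fintype ι] [DecidableEq ι] {T : Finset ι} {i j : ι}
    (hi : i ∈ T) (h : T.erase i = Finset.univ.erase j) : T = Finset.univ ∧ i = j := by
  have hij : i = j := by_contra fun hne =>
    Finset.notMem_erase i T (h ▸ Finset.mem_erase.2 ⟨hne, Finset.mem_univ i⟩)
  exact ⟨by rw [← Finset.insert_erase hi, h, hij, Finset.insert_erase (Finset.mem_univ j)], hij⟩

theorem topClass_cechRestrict (j : Fin m) (w : CechLoc a (Finset.univ.erase j)) :
    topClass a (cechRestrict a (Finset.erase_subset j Finset.univ) w) = 0 := by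
  let y : CechCochain a := Pi.single (Finset.univ.erase j) ((alternatingSign j Finset.univ : R) • w)
  refine (topClass_eq_zero_iff a).2 ⟨y, funext fun T => ?_⟩
  have hy : y (Finset.univ.erase j) = (alternatingSign j Finset.univ : R) • w :=
    Pi.single_eq_same _ _
  have hzero : ∀ i ∈ T, T ≠ Finset.univ ∨ i ≠ j → restrictTo a T (T.erase i) y = 0 :=
    fun i hi h => restrictTo_eq_zero a T <| Pi.single_eq_of_ne (fun heq => by
      obtain ⟨rfl, rfl⟩ := eq_univ_and_eq_of_erase_eq hi heq
      exact h.elim (· rfl) (· rfl)) _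
  rw [cechD_apply_eq_sum_restrictTo]
  by_cases hT : T = Finset.univ
  · subst hT
    rw [Finset.sum_eq_single_of_mem j (Finset.mem_univ j) fun i hi hij => by
      rw [hzero i hi (Or.inr hij), smul_zero], restrictTo_of_subset a (Finset.erase_subset j _),
      hy, Pi.single_eq_same, map_smul, smul_smul, ← Int.cast_mul, alternatingSign_mul_self,
      Int.cast_one, one_smul]
  · rw [Pi.single_eq_of_ne hT]
    exact Finset.sum_eq_zero fun i hi => by rw [hzero i hi (Or.inl hT), smul_zero]

theorem algebraMap_prod_univ (j : Fin m) : algebraMap R (CechLoc a Finset.univ) (∏ i, a i) =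
    algebraMap R _ (a j) * algebraMap R _ (∏ i ∈ Finset.univ.erase j, a i) := by
  rw [← map_mul, Finset.mul_prod_erase _ _ (Finset.mem_univ j)]

theorem smul_invSelf_eq_cechRestrict (j : Fin m) :
    a j • IsLocalization.Away.invSelf (S := CechLoc a Finset.univ) (∏ i, a i) =
      cechRestrict a (Finset.erase_subset j Finset.univ)
        (IsLocalization.Away.invSelf (∏ i ∈ Finset.univ.erase j, a i)) := by
  have hinv := IsLocalization.Away.mul_invSelf (S := CechLoc a Finset.univ) (∏ i, a i)
  have hinv' := congrArg (cechRestrict a (Finset.erase_subset j Finset.univ))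
    (IsLocalization.Away.mul_invSelf (∏ i ∈ Finset.univ.erase j, a i))
  rw [map_mul, AlgHom.commutes, map_one] at hinv'
  rw [algebraMap_prod_univ a j] at hinv
  rw [Algebra.smul_def]
  linear_combination cechRestrict a (Finset.erase_subset j Finset.univ)
    (IsLocalization.Away.invSelf (∏ i ∈ Finset.univ.erase j, a i)) * hinv -
    algebraMap R _ (a j) * IsLocalization.Away.invSelf (∏ i, a i) * hinv'

theorem eventually_pow_smul_cechRestrict_mem (j : Fin m) (w : CechLoc a (Finset.univ.erase j)) :
    ∀ᶠ M in Filter.atTop,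
      (∏ i, a i) ^ M • cechRestrict a (Finset.erase_subset j Finset.univ) w ∈
        Submodule.map (Algebra.linearMap R _) (Ideal.span (Set.range fun i => a i ^ M)) := by
  obtain ⟨n, r, hr⟩ := IsLocalization.Away.surj (∏ i ∈ Finset.univ.erase j, a i) w
  refine Filter.eventually_atTop.2 ⟨n, fun M hM => ?_⟩
  obtain ⟨k, rfl⟩ := Nat.exists_eq_add_of_le hM
  refine ⟨(∏ i ∈ Finset.univ.erase j, a i) ^ k * r * a j ^ (n + k),
    Ideal.mul_mem_left _ _ (Ideal.subset_span ⟨j, rfl⟩), ?_⟩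
  have hr' := congrArg (cechRestrict a (Finset.erase_subset j Finset.univ)) hr
  rw [map_mul, map_pow, AlgHom.commutes, AlgHom.commutes] at hr'
  rw [Algebra.linearMap_apply, Algebra.smul_def, map_pow, algebraMap_prod_univ a j, map_mul,
    map_mul, ← hr', map_pow, map_pow]
  ring

theorem eventually_pow_smul_cechD_mem (y : CechCochain a) :
    ∀ᶠ M in Filter.atTop, (∏ i, a i) ^ M • cechD a y Finset.univ ∈
      Submodule.map (Algebra.linearMap R _) (Ideal.span (Set.range fun i => a i ^ M)) := by
  have h := Filter.eventually_all.2 fun j =>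
    eventually_pow_smul_cechRestrict_mem a j (y (Finset.univ.erase j))
  filter_upwards [h] with M hM
  rw [cechD_apply_eq_sum_restrictTo, Finset.smul_sum]
  refine Submodule.sum_mem _ fun j _ => ?_
  rw [restrictTo_of_subset a (Finset.erase_subset j _), smul_comm]
  exact Submodule.smul_mem _ _ (hM j)

/-- The class of `1 / (a_1 ⋯ a_m) ^ N` in the top Čech cohomology. -/
def invPowClass (N : ℕ) : CechCohomology a m :=
  topClass a (IsLocalization.Away.invSelf (∏ i, a i) ^ N)

theorem exists_smul_invPowClass (x : CechCohomology a m) :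
    ∃ (N : ℕ) (r : R), x = r • invPowClass a N := by
  obtain ⟨z, rfl⟩ := topClass_surjective a x
  obtain ⟨N, r, hr⟩ := IsLocalization.Away.surj (∏ i, a i) z
  refine ⟨N, r, ?_⟩
  rw [invPowClass, ← map_smul, Algebra.smul_def, ← hr, mul_assoc, ← mul_pow,
    IsLocalization.Away.mul_invSelf, one_pow, mul_one]

theorem prod_pow_smul_invPowClass (N k : ℕ) :
    (∏ i, a i) ^ k • invPowClass a (N + k) = invPowClass a N := by
  rw [invPowClass, ← map_smul, Algebra.smul_def, map_pow, pow_add, mul_left_comm, ← mul_pow,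
    IsLocalization.Away.mul_invSelf, one_pow, mul_one, invPowClass]

theorem pow_smul_invPowClass (j : Fin m) (N : ℕ) : a j ^ N • invPowClass a N = 0 := by
  rw [invPowClass, ← map_smul, ← smul_pow, smul_invSelf_eq_cechRestrict, ← map_pow,
    topClass_cechRestrict]

theorem prod_pow_mul_mem_span_pow {q : R} {M : ℕ} (l : ℕ)
    (hq : q ∈ Ideal.span (Set.range fun i => a i ^ M)) :
    (∏ i, a i) ^ l * q ∈ Ideal.span (Set.range fun i => a i ^ (M + l)) := by
  have hle : Ideal.span (Set.range fun i => a i ^ M) ≤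
      Submodule.comap (LinearMap.mulLeft R ((∏ i, a i) ^ l))
        (Ideal.span (Set.range fun i => a i ^ (M + l))) := by
    refine Ideal.span_le.2 (Set.range_subset_iff.2 fun j => ?_)
    have hmul : (∏ i, a i) ^ l * a j ^ M =
        (∏ i ∈ Finset.univ.erase j, a i) ^ l * a j ^ (M + l) := by
      rw [← Finset.mul_prod_erase _ _ (Finset.mem_univ j)]
      ring
    rw [SetLike.mem_coe, Submodule.mem_comap, LinearMap.mulLeft_apply, hmul]
    exact Ideal.mul_mem_left _ _ (Ideal.subset_span ⟨j, rfl⟩)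
  exact hle hq

theorem prod_pow_mul_mem_of_smul_invPowClass_eq_zero {r : R} {N : ℕ}
    (h : r • invPowClass a N = 0) :
    ∃ k, (∏ i, a i) ^ k * r ∈ Ideal.span (Set.range fun i => a i ^ (N + k)) := by
  rw [invPowClass, ← map_smul, topClass_eq_zero_iff] at h
  obtain ⟨y, hy⟩ := h
  obtain ⟨M, hM⟩ := ((eventually_pow_smul_cechD_mem a y).and
    (Filter.eventually_ge_atTop N)).exists
  obtain ⟨⟨q, hq, hqM⟩, hNM⟩ := hM
  obtain ⟨k, rfl⟩ := Nat.exists_eq_add_of_le hNM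
  have hx : algebraMap R (CechLoc a Finset.univ) (∏ i, a i) ^ N *
      IsLocalization.Away.invSelf (∏ i, a i) ^ N = 1 := by
    rw [← mul_pow, IsLocalization.Away.mul_invSelf, one_pow]
  rw [hy, Pi.single_eq_same, Algebra.linearMap_apply, Algebra.smul_def, Algebra.smul_def,
    map_pow, pow_add] at hqM
  have hqk : algebraMap R (CechLoc a Finset.univ) ((∏ i, a i) ^ k * r) = algebraMap R _ q := by
    rw [hqM, map_mul, map_pow]
    linear_combination -algebraMap R _ (∏ i, a i) ^ k * algebraMap R _ r * hx
  obtain ⟨⟨_, l, rfl⟩, hl⟩ := IsLocalization.exists_of_eq (M := Submonoid.powers (∏ i, a i)) hqk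
  refine ⟨k + l, ?_⟩
  rw [pow_add, mul_comm (_ ^ k), mul_assoc, ← add_assoc]
  exact hl ▸ prod_pow_mul_mem_span_pow a l hq

theorem smul_invPowClass_eq_zero_iff {r : R} {N : ℕ} : r • invPowClass a N = 0 ↔
    ∃ k, (∏ i, a i) ^ k * r ∈ Ideal.span (Set.range fun i => a i ^ (N + k)) := by
  refine ⟨prod_pow_mul_mem_of_smul_invPowClass_eq_zero a, fun ⟨k, hk⟩ => ?_⟩
  have hle : Ideal.span (Set.range fun i => a i ^ (N + k)) ≤
      LinearMap.ker (LinearMap.toSpanSingleton R _ (invPowClass a (N + k))) :=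
    Ideal.span_le.2 (Set.range_subset_iff.2 fun i => pow_smul_invPowClass a i (N + k))
  rw [← prod_pow_smul_invPowClass a N k, smul_smul, mul_comm]
  exact hle hk

theorem derivation_mul_inv_pow {K A : Type*} [CommRing K] [CommRing A] [Algebra K A]
    (D : Derivation K A A) {u y : A} (h : u * y = 1) (r : A) (N : ℕ) :
    D (r * y ^ N) = (u * D r - N * D u * r) * y ^ (N + 1) := by
  have hDy : D y = -y ^ 2 * D u := D.leibniz_of_mul_eq_one ((mul_comm y u).trans h)
  rw [Derivation.leibniz, Derivation.leibniz_pow, hDy]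
  simp only [smul_eq_mul, nsmul_eq_mul]
  cases N with
  | zero =>
    simp only [Nat.cast_zero]
    linear_combination -D r * h
  | succ N =>
    rw [Nat.add_sub_cancel]
    linear_combination -D r * y ^ (N + 1) * h

theorem cohomologyAction_smul_invPowClass {K : Type*} [CommRing K] [Algebra K R]
    (D : Derivation K R R) (r : R) (N : ℕ) :
    cohomologyAction a D m (r • invPowClass a N) =
      ((∏ i, a i) * D r - N * D (∏ i, a i) * r) • invPowClass a (N + 1) := by
  have hinv := IsLocalization.Away.mul_invSelf (S := CechLoc a Finset.univ) (∏ i, a i)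
  rw [invPowClass, ← map_smul, cohomologyAction_topClass, invPowClass, ← map_smul,
    Algebra.smul_def, Algebra.smul_def, derivation_mul_inv_pow _ hinv, locDerivation_algebraMap,
    locDerivation_algebraMap]
  simp only [map_sub, map_mul, map_natCast]

end TopCech

section Laurent

open MvPolynomial

variable {K σ : Type*} {g : ℕ} (e : Fin g ↪ σ)

/-- The exponent of the squarefree monomial `∏ j, X (e j)`. -/
def axisExp : σ →₀ ℕ := ∑ j, Finsupp.single (e j) 1

theorem axisExp_apply_emb (j : Fin g) : axisExp e (e j) = 1 := by
  classical
  simp only [axisExp, Finsupp.finsetSum_apply, Finsupp.single_apply, e.apply_eq_iff_eq,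
    Finset.sum_ite_eq', Finset.mem_univ, if_true]

theorem axisExp_apply_of_notMem {i : σ} (hi : i ∉ Set.range e) : axisExp e i = 0 := by
  classical
  rw [axisExp, Finsupp.finsetSum_apply]
  exact Finset.sum_eq_zero fun j _ => Finsupp.single_eq_of_ne fun h => hi ⟨j, h.symm⟩

section
variable [CommRing K]

variable (K) in
/-- The coordinates indexed by the range of `e`. -/
abbrev coordSeq : Fin g → MvPolynomial σ K := fun j => X (e j)

theorem prod_coordSeq : ∏ j, coordSeq K e j = monomial (axisExp e) 1 :=
  (monomial_sum_one Finset.univ fun j => Finsupp.single (e j) 1).symm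

theorem smul_invPowClass_coordSeq_eq_zero_iff {r : MvPolynomial σ K} {N : ℕ} :
    r • invPowClass (coordSeq K e) N = 0 ↔ ∀ β ∈ r.support, ∃ j, N ≤ β (e j) := by
  have hmem : ∀ (q : MvPolynomial σ K) (M : ℕ),
      q ∈ Ideal.span (Set.range fun j => coordSeq K e j ^ M) ↔
        ∀ β ∈ q.support, ∃ j, M ≤ β (e j) := fun q M => by
    have himage : (Set.range fun j => coordSeq K e j ^ M) =
        (fun α => monomial α (1 : K)) '' Set.range fun j => Finsupp.single (e j) M := by
      rw [← Set.range_comp]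
      exact congrArg Set.range (funext fun j => X_pow_eq_monomial)
    simp only [himage, mem_ideal_span_monomial_image, Set.exists_range_iff, Finsupp.single_le_iff]
  rw [smul_invPowClass_eq_zero_iff]
  refine ⟨fun ⟨k, hk⟩ β hβ => ?_, fun h => ⟨0, ?_⟩⟩
  · rw [hmem, prod_coordSeq, monomial_pow, one_pow] at hk
    obtain ⟨j, hj⟩ := hk (k • axisExp e + β) <| by
      rwa [mem_support_iff, coeff_monomial_mul, one_mul, ← mem_support_iff]
    refine ⟨j, ?_⟩
    rw [Finsupp.add_apply, Finsupp.smul_apply, axisExp_apply_emb, smul_eq_mul, mul_one] at hj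
    omega
  · rw [pow_zero, one_mul, hmem]
    exact h

theorem monomial_smul_invPowClass_add (β : σ →₀ ℕ) (N k : ℕ) :
    monomial (k • axisExp e + β) (1 : K) • invPowClass (coordSeq K e) (N + k) =
      monomial β (1 : K) • invPowClass (coordSeq K e) N := by
  rw [← prod_pow_smul_invPowClass _ N k, smul_smul, prod_coordSeq, monomial_pow, one_pow,
    monomial_mul, one_mul, add_comm β]

end

/-- The exponents `α` and `β` are exchanged by the involution `k ↦ N - 1 - k` in the directions of
`e` and agree in the others, so that `X ^ β / (∏ j, X (e j)) ^ N` is the Laurent monomial with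
exponents `-α i - 1` for `i` in the range of `e` and `α i` otherwise. -/
def IsReflection (N : ℕ) (α β : σ →₀ ℕ) : Prop :=
  (∀ j, α (e j) + β (e j) + 1 = N) ∧ ∀ i ∉ Set.range e, α i = β i

variable {e} {N : ℕ} {α β : σ →₀ ℕ}

theorem IsReflection.symm (h : IsReflection e N α β) : IsReflection e N β α :=
  ⟨fun j => add_comm (α (e j)) (β (e j)) ▸ h.1 j, fun i hi => (h.2 i hi).symm⟩

theorem IsReflection.lt (h : IsReflection e N α β) (j : Fin g) : β (e j) < N := by
  have := h.1 j
  omega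

theorem eq_of_apply_emb_eq {γ : σ →₀ ℕ} (h : ∀ j, β (e j) = γ (e j))
    (h' : ∀ i ∉ Set.range e, β i = γ i) : β = γ := by
  ext i
  by_cases hi : i ∈ Set.range e
  · obtain ⟨j, rfl⟩ := hi
    exact h j
  · exact h' i hi

theorem IsReflection.unique {γ : σ →₀ ℕ} (h : IsReflection e N α β) (h' : IsReflection e N α γ) :
    β = γ :=
  eq_of_apply_emb_eq (fun j => by have := h.1 j; have := h'.1 j; omega)
    fun i hi => (h.2 i hi).symm.trans (h'.2 i hi)

theorem apply_lt_degree_add_one (α : σ →₀ ℕ) (i : σ) : α i < α.degree + 1 :=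
  Nat.lt_succ_of_le (Finsupp.le_degree i α)

variable [Finite σ]

open scoped Classical in
variable (e) in
/-- The exponent related to `α` by `IsReflection e N`. Truncated subtraction makes this meaningful
only if `α < N` in the directions of `e`. -/
def reflect (N : ℕ) (α : σ →₀ ℕ) : σ →₀ ℕ :=
  Finsupp.equivFunOnFinite.symm fun i => if i ∈ Set.range e then N - 1 - α i else α i

theorem isReflection_reflect (h : ∀ j, α (e j) < N) : IsReflection e N α (reflect e N α) := by
  refine ⟨fun j => ?_, fun i hi => ?_⟩
  · have := h j
    simp only [reflect, Finsupp.equivFunOnFinite_symm_apply_apply, Set.mem_range_self, if_true]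
    omega
  · simp only [reflect, Finsupp.equivFunOnFinite_symm_apply_apply, if_neg hi]

theorem exists_isReflection (α : σ →₀ ℕ) : ∃ N β, IsReflection e N α β :=
  ⟨_, _, isReflection_reflect fun j => apply_lt_degree_add_one α (e j)⟩

variable [CommRing K]

variable (K e) in
/-- The class of the Laurent monomial with exponents `-α i - 1` for `i` in the range of `e` and
`α i` otherwise. -/
def laurentClass (α : σ →₀ ℕ) : CechCohomology (coordSeq K e) g :=
  monomial (reflect e (α.degree + 1) α) (1 : K) • invPowClass (coordSeq K e) (α.degree + 1)

theorem laurentClass_eq (h : IsReflection e N α β) :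
    laurentClass K e α = monomial β (1 : K) • invPowClass (coordSeq K e) N := by
  have h' := isReflection_reflect (e := e) fun j => apply_lt_degree_add_one α (e j)
  have hexp : N • axisExp e + reflect e (α.degree + 1) α = (α.degree + 1) • axisExp e + β := by
    refine eq_of_apply_emb_eq (e := e) (fun j => ?_) fun i hi => ?_
    · have := h.1 j
      have := h'.1 j
      simp only [Finsupp.add_apply, Finsupp.smul_apply, axisExp_apply_emb, smul_eq_mul, mul_one]
      omega
    · simp only [Finsupp.add_apply, Finsupp.smul_apply, axisExp_apply_of_notMem e hi, smul_zero,
        zero_add, ← h.2 i hi, ← h'.2 i hi]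
  rw [laurentClass, ← monomial_smul_invPowClass_add e _ _ N, hexp, add_comm (α.degree + 1) N,
    monomial_smul_invPowClass_add]

theorem linearIndependent_laurentClass : LinearIndependent K (laurentClass K e) := by
  classical
  rw [linearIndependent_iff']
  intro t c hc α hα
  obtain ⟨N, hN⟩ : ∃ N, ∀ γ ∈ t, ∀ j, γ (e j) < N := ⟨t.sup Finsupp.degree + 1, fun γ hγ j =>
    Nat.lt_succ_of_le ((Finsupp.le_degree _ γ).trans (Finset.le_sup (f := Finsupp.degree) hγ))⟩
  have href : ∀ γ ∈ t, IsReflection e N γ (reflect e N γ) := fun γ hγ =>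
    isReflection_reflect (hN γ hγ)
  let r : MvPolynomial σ K := ∑ γ ∈ t, monomial (reflect e N γ) (c γ)
  have hr : r • invPowClass (coordSeq K e) N = 0 := by
    rw [← hc, Finset.sum_smul]
    refine Finset.sum_congr rfl fun γ hγ => ?_
    rw [laurentClass_eq (href γ hγ), ← smul_assoc, smul_monomial, smul_eq_mul, mul_one]
  have hcoeff : coeff (reflect e N α) r = c α := by
    rw [coeff_sum, Finset.sum_eq_single_of_mem α hα, coeff_monomial, if_pos rfl]
    intro γ hγ hne
    rw [coeff_monomial, if_neg]
    exact fun h => hne ((h ▸ href γ hγ).symm.unique (href α hα).symm)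
  by_contra hcα
  obtain ⟨j, hj⟩ := (smul_invPowClass_coordSeq_eq_zero_iff e).1 hr (reflect e N α)
    (mem_support_iff.2 (hcoeff.trans_ne hcα))
  exact hj.not_gt ((href α hα).lt j)

theorem span_laurentClass : ⊤ ≤ Submodule.span K (Set.range (laurentClass K e)) := by
  intro x _
  obtain ⟨N, r, rfl⟩ := exists_smul_invPowClass (coordSeq K e) x
  rw [r.as_sum, Finset.sum_smul]
  refine Submodule.sum_mem _ fun β _ => ?_
  rw [← mul_one (coeff β r), ← smul_eq_mul, ← smul_monomial, smul_assoc]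
  refine Submodule.smul_mem _ _ ?_
  by_cases hβ : ∀ j, β (e j) < N
  · rw [← laurentClass_eq (isReflection_reflect hβ).symm]
    exact Submodule.subset_span ⟨_, rfl⟩
  · push Not at hβ
    obtain ⟨j, hj⟩ := hβ
    rw [(smul_invPowClass_coordSeq_eq_zero_iff e).2 fun γ hγ =>
      ⟨j, by rwa [Finset.mem_singleton.1 (support_monomial_subset hγ)]⟩]
    exact Submodule.zero_mem _

variable (K e) in
/-- The basis of the top local cohomology module at the coordinate subspace `X (e j) = 0` that
consists of Laurent monomials. -/
def laurentBasis : Module.Basis (σ →₀ ℕ) K (CechCohomology (coordSeq K e) g) :=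
  Module.Basis.mk linearIndependent_laurentClass span_laurentClass

end Laurent

section Derivatives

open MvPolynomial

theorem monomial_mul_pderiv_sub {K σ : Type*} [CommRing K] (μ β : σ →₀ ℕ) (i : σ) (N : ℕ) :
    monomial μ 1 * pderiv i (monomial β (1 : K)) -
        (N : MvPolynomial σ K) * pderiv i (monomial μ 1) * monomial β 1 =
      monomial (μ + β - Finsupp.single i 1) (β i - N * μ i : K) := by
  have hleft : monomial μ 1 * pderiv i (monomial β (1 : K)) =
      monomial (μ + β - Finsupp.single i 1) (β i : K) := by
    rw [pderiv_monomial, monomial_mul, one_mul, one_mul]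
    by_cases hβ : β i = 0
    · simp only [hβ, Nat.cast_zero, monomial_zero]
    · rw [add_tsub_assoc_of_le (Finsupp.single_le_iff.2 (Nat.one_le_iff_ne_zero.2 hβ))]
  have hright : pderiv i (monomial μ (1 : K)) * monomial β 1 =
      monomial (μ + β - Finsupp.single i 1) (μ i : K) := by
    rw [pderiv_monomial, monomial_mul, one_mul, mul_one]
    by_cases hμ : μ i = 0
    · simp only [hμ, Nat.cast_zero, monomial_zero]
    · rw [tsub_add_eq_add_tsub (Finsupp.single_le_iff.2 (Nat.one_le_iff_ne_zero.2 hμ))]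
  rw [hleft, mul_assoc, hright, map_sub, ← map_natCast C, C_mul_monomial]

variable {K σ : Type*} [CommRing K] [Finite σ] {g : ℕ} {e : Fin g ↪ σ}

theorem cohomologyAction_laurentClass {N : ℕ} {α β : σ →₀ ℕ} (h : IsReflection e N α β) (i : σ) :
    cohomologyAction (coordSeq K e) (pderiv i) g (laurentClass K e α) =
      (β i - N * axisExp e i : K) •
        monomial (axisExp e + β - Finsupp.single i 1) (1 : K) •
          invPowClass (coordSeq K e) (N + 1) := by
  rw [laurentClass_eq h, cohomologyAction_smul_invPowClass, prod_coordSeq, monomial_mul_pderiv_sub,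
    ← smul_assoc, smul_monomial, smul_eq_mul, mul_one]

theorem cohomologyAction_laurentClass_emb (α : σ →₀ ℕ) (j : Fin g) :
    cohomologyAction (coordSeq K e) (pderiv (e j)) g (laurentClass K e α) =
      -(α (e j) + 1 : K) • laurentClass K e (α + Finsupp.single (e j) 1) := by
  classical
  obtain ⟨N, β, h⟩ := exists_isReflection (e := e) α
  have h' : IsReflection e (N + 1) (α + Finsupp.single (e j) 1)
      (axisExp e + β - Finsupp.single (e j) 1) := by
    refine ⟨fun k => ?_, fun i hi => ?_⟩
    · have := h.1 k
      simp only [Finsupp.add_apply, Finsupp.tsub_apply, axisExp_apply_emb, Finsupp.single_apply]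
      split_ifs <;> omega
    · have hij : i ≠ e j := fun hij => hi ⟨j, hij.symm⟩
      simp only [Finsupp.add_apply, Finsupp.tsub_apply, axisExp_apply_of_notMem e hi,
        Finsupp.single_eq_of_ne hij, add_zero, zero_add, tsub_zero, h.2 i hi]
  rw [cohomologyAction_laurentClass h, laurentClass_eq h', axisExp_apply_emb, ← h.1 j]
  congr 1
  push_cast
  ring

theorem cohomologyAction_laurentClass_of_eq_zero {α : σ →₀ ℕ} {i : σ} (hi : i ∉ Set.range e)
    (hα : α i = 0) :
    cohomologyAction (coordSeq K e) (pderiv i) g (laurentClass K e α) = 0 := by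
  obtain ⟨N, β, h⟩ := exists_isReflection (e := e) α
  rw [cohomologyAction_laurentClass h, ← h.2 i hi, hα, axisExp_apply_of_notMem e hi, Nat.cast_zero,
    mul_zero, sub_zero, zero_smul]

theorem cohomologyAction_laurentClass_add_single (α : σ →₀ ℕ) {i : σ} (hi : i ∉ Set.range e) :
    cohomologyAction (coordSeq K e) (pderiv i) g (laurentClass K e (α + Finsupp.single i 1)) =
      (α i + 1 : K) • laurentClass K e α := by
  obtain ⟨N, β, h⟩ := exists_isReflection (e := e) (α + Finsupp.single i 1)
  have h' : IsReflection e (N + 1) α (axisExp e + β - Finsupp.single i 1) := by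
    refine ⟨fun k => ?_, fun l hl => ?_⟩
    · have hk : e k ≠ i := fun hk => hi ⟨k, hk⟩
      have := h.1 k
      simp only [Finsupp.add_apply, Finsupp.tsub_apply, axisExp_apply_emb,
        Finsupp.single_eq_of_ne hk] at this ⊢
      omega
    · rw [Finsupp.tsub_apply, Finsupp.add_apply, axisExp_apply_of_notMem e hl, ← h.2 l hl,
        Finsupp.add_apply, zero_add, Nat.add_sub_cancel]
  rw [cohomologyAction_laurentClass h, laurentClass_eq h', axisExp_apply_of_notMem e hi,
    ← h.2 i hi, Finsupp.add_apply, Finsupp.single_eq_same]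
  congr 1
  push_cast
  ring

end Derivatives

section Fourier

open MvPolynomial
open scoped Nat

variable {K σ : Type*} [Fintype σ]

theorem prod_apply_add_single {M : Type*} [CommMonoid M] {f : σ → ℕ → M} {c : M} {α : σ →₀ ℕ}
    {i : σ} (h : f i (α i + 1) = c * f i (α i)) :
    ∏ k, f k ((α + Finsupp.single i 1 : σ →₀ ℕ) k) = c * ∏ k, f k (α k) := by
  classical
  have herase : ∀ k ∈ Finset.univ.erase i, f k ((α + Finsupp.single i 1 : σ →₀ ℕ) k) = f k (α k) :=
    fun k hk => by
      rw [Finsupp.add_apply, Finsupp.single_eq_of_ne (Finset.ne_of_mem_erase hk), add_zero]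
  rw [← Finset.mul_prod_erase _ _ (Finset.mem_univ i),
    ← Finset.mul_prod_erase Finset.univ (fun k => f k (α k)) (Finset.mem_univ i),
    Finset.prod_congr rfl herase, Finsupp.add_apply, Finsupp.single_eq_same, h, mul_assoc]

variable [DecidableEq σ] {g : ℕ} (e : Fin g ↪ σ) {α : σ →₀ ℕ}

/-- The contribution of an exponent `k` in direction `i` to `fourierWeight`. -/
def fourierFactor (i : σ) (k : ℕ) : ℚ :=
  if i ∈ Finset.univ.map e then (-1) ^ k * (k ! : ℚ) else (k ! : ℚ)⁻¹

/-- The scalar by which the Laurent monomial indexed by `α` has to be multiplied for the partial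
derivatives to act on the rescaled monomials with coefficients `0` and `1`. -/
def fourierWeight (α : σ →₀ ℕ) : ℚ := ∏ i, fourierFactor e i (α i)

theorem fourierWeight_ne_zero : fourierWeight e α ≠ 0 :=
  Finset.prod_ne_zero_iff.2 fun i _ => by
    unfold fourierFactor
    split_ifs <;> simp [Nat.factorial_ne_zero]

variable {e}

theorem fourierWeight_add_single_of_mem {i : σ} (hi : i ∈ Finset.univ.map e) :
    fourierWeight e (α + Finsupp.single i 1) = -(α i + 1) * fourierWeight e α :=
  prod_apply_add_single <| by
    rw [fourierFactor, fourierFactor, if_pos hi, if_pos hi, Nat.factorial_succ, pow_succ]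
    push_cast
    ring

theorem fourierWeight_add_single_of_notMem {i : σ} (hi : i ∉ Finset.univ.map e) :
    fourierWeight e (α + Finsupp.single i 1) = (α i + 1 : ℚ)⁻¹ * fourierWeight e α :=
  prod_apply_add_single <| by
    rw [fourierFactor, fourierFactor, if_neg hi, if_neg hi, Nat.factorial_succ,
      Nat.cast_mul, mul_inv, Nat.cast_succ]

variable [CommRing K] [Algebra ℚ K]

variable (K e) in
/-- The isomorphism, a Fourier transform in the directions of `e`, from polynomials onto the top
local cohomology module at the coordinate subspace `X (e j) = 0`. -/
def fourierEquiv : MvPolynomial σ K ≃ₗ[K] CechCohomology (coordSeq K e) g :=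
  (basisMonomials σ K).equiv
    ((laurentBasis K e).isUnitSMul fun α =>
      (IsUnit.mk0 _ (fourierWeight_ne_zero e (α := α))).map (algebraMap ℚ K)) (Equiv.refl _)

theorem fourierEquiv_monomial (α : σ →₀ ℕ) :
    fourierEquiv K e (monomial α 1) = algebraMap ℚ K (fourierWeight e α) • laurentClass K e α := by
  refine ((basisMonomials σ K).equiv_apply α _ _).trans ?_
  rw [Module.Basis.isUnitSMul_apply, Equiv.refl_apply, laurentBasis, Module.Basis.mk_apply]

theorem fourierEquiv_mulX {i : σ} (hi : i ∈ Finset.univ.map e) :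
    (fourierEquiv K e).toLinearMap ∘ₗ mulX i =
      cohomologyAction (coordSeq K e) (pderiv i) g ∘ₗ (fourierEquiv K e).toLinearMap := by
  refine (basisMonomials σ K).ext fun α => ?_
  obtain ⟨j, -, rfl⟩ := Finset.mem_map.1 hi
  simp only [LinearMap.comp_apply, LinearEquiv.coe_coe, coe_basisMonomials, mulX_monomial,
    fourierEquiv_monomial, map_smul, cohomologyAction_laurentClass_emb,
    fourierWeight_add_single_of_mem hi, smul_smul]
  congr 1
  push_cast
  ring

theorem fourierEquiv_divX {i : σ} (hi : i ∉ Finset.univ.map e) :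
    (fourierEquiv K e).toLinearMap ∘ₗ divX i =
      cohomologyAction (coordSeq K e) (pderiv i) g ∘ₗ (fourierEquiv K e).toLinearMap := by
  refine (basisMonomials σ K).ext fun α => ?_
  have hi' : i ∉ Set.range e := by simpa using hi
  simp only [LinearMap.comp_apply, LinearEquiv.coe_coe, coe_basisMonomials,
    fourierEquiv_monomial, map_smul]
  by_cases hα : α i = 0
  · rw [divX_monomial_of_eq_zero hα, map_zero, cohomologyAction_laurentClass_of_eq_zero hi' hα,
      smul_zero]
  · obtain ⟨γ, rfl⟩ : ∃ γ, α = γ + Finsupp.single i 1 :=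
      ⟨_, (tsub_add_cancel_of_le (Finsupp.single_le_iff.2 (Nat.one_le_iff_ne_zero.2 hα))).symm⟩
    have hne : (γ i + 1 : ℚ) ≠ 0 := by positivity
    have hweight : algebraMap ℚ K (fourierWeight e (γ + Finsupp.single i 1)) * (γ i + 1) =
        algebraMap ℚ K (fourierWeight e γ) := by
      rw [fourierWeight_add_single_of_notMem hi, ← map_natCast (algebraMap ℚ K), ← map_one
        (algebraMap ℚ K), ← map_add, ← map_mul, mul_right_comm, inv_mul_cancel₀ hne, one_mul]
    rw [divX_monomial_add_single, fourierEquiv_monomial,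
      cohomologyAction_laurentClass_add_single γ hi', smul_smul, hweight]

theorem areConjugate_piecewise_cohomologyAction :
    AreConjugate ((Finset.univ.map e)ᶜ.piecewise divX mulX)
      fun i => cohomologyAction (coordSeq K e) (pderiv i) g := by
  refine ⟨fourierEquiv K e, fun i x => ?_⟩
  by_cases hi : i ∈ Finset.univ.map e
  · rw [Finset.piecewise_eq_of_notMem _ _ _ (Finset.notMem_compl.2 hi)]
    exact LinearMap.congr_fun (fourierEquiv_mulX hi) x
  · rw [Finset.piecewise_eq_of_mem _ _ _ (Finset.mem_compl.2 hi)]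
    exact LinearMap.congr_fun (fourierEquiv_divX hi) x

end Fourier

end DeRhamLC

end

open DeRhamLC in
theorem theorem4p3_general {K σ : Type*} [CommRing K] [Algebra ℚ K] [Fintype σ] [LinearOrder σ]
    {g s : ℕ} (e : Fin g ↪ σ) (a : Fin s → MvPolynomial σ K)
    (ha : (Ideal.span (Set.range a)).radical =
      (Ideal.span (Set.range fun j => MvPolynomial.X (e j))).radical) :
    (∀ i ≠ Fintype.card σ - g,
      Subsingleton (KoszulHomology (fun k => cohomologyAction a (MvPolynomial.pderiv k) g) i)) ∧
    Nonempty (KoszulHomology (fun k => cohomologyAction a (MvPolynomial.pderiv k) g)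
      (Fintype.card σ - g) ≃ₗ[K] K) := by
  have hcard : Fintype.card σ - g = (Finset.univ.map e)ᶜ.card := by
    rw [Finset.card_compl, Finset.card_map, Finset.card_univ, Fintype.card_fin]
  have hconj := areConjugate_piecewise_cohomologyAction.trans
    (areConjugate_cohomologyAction MvPolynomial.pderiv g ha.symm)
  rw [hcard]
  refine ⟨fun i hi => ?_, ?_⟩
  · obtain ⟨E⟩ := hconj.nonempty_koszulHomology_equiv i
    have := isShiftSystem_divX_mulX.subsingleton_koszulHomology (K := K) hi
    exact E.symm.injective.subsingleton
  · obtain ⟨E⟩ := hconj.nonempty_koszulHomology_equiv (Finset.univ.map e)ᶜ.card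
    exact ⟨E.symm ≪≫ₗ (isShiftSystem_divX_mulX.koszulHomologyEquiv _).symm ≪≫ₗ iInfKerDivXEquiv⟩

theorem theorem4p3 {K : Type*} [Field K] [CharZero K] (n : ℕ) (hn : 1 ≤ n)
    (s : ℕ) (a : Fin s → MvPolynomial (Fin n) K)
    (ha : Ideal.span (Set.range a) =
      Ideal.span {x | ∃ i : Fin n, (i : ℕ) < n - 1 ∧ x = MvPolynomial.X i}) :
    (∀ i : ℕ, i ≠ 1 →
      Subsingleton (DeRhamLC.KoszulHomology (DeRhamLC.partialOp a (n - 1)) i)) ∧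
    Nonempty (DeRhamLC.KoszulHomology (DeRhamLC.partialOp a (n - 1)) 1 ≃ₗ[K] K) := by
  have hX : {x | ∃ i : Fin n, (i : ℕ) < n - 1 ∧ x = MvPolynomial.X (R := K) i} =
      Set.range fun j => MvPolynomial.X (Fin.castLEEmb (n.sub_le 1) j) :=
    Set.ext fun x => ⟨fun ⟨i, hi, hx⟩ => ⟨⟨i, hi⟩, hx.symm⟩, fun ⟨j, hj⟩ => ⟨_, j.2, hj.symm⟩⟩
  have hcard : Fintype.card (Fin n) - (n - 1) = 1 := by
    rw [Fintype.card_fin, Nat.sub_sub_self hn]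
  have h := theorem4p3_general (Fin.castLEEmb (n.sub_le 1)) a (congrArg Ideal.radical (hX ▸ ha))
  rwa [hcard] at h
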